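/- Alphabets are finite sets, $\lambda$ is the empty word, and a language over an alphabet $\Sigma$ is a subset of $\Sigma^*$. **Linear indexed grammars.** An indexed grammar is a tuple $G=(V,\Sigma,I,P,S)$ with pairwise disjoint finite sets $V$ (nonterminals), $\Sigma$ (terminals) and $I$ (indices), a start symbol $S\in V$, and a finite set $P$ of productions, each of one of the forms (1) $A\to\nu$, (2) $A\to Bf$, (3) $Af\to\nu$, where $A,B\in V$, $f\in I$, $\nu\in(V\cup\Sigma)^*$. Sentential forms are words in $(VI^*\cup\Sigma)^*$. For $\nu\in(V\cup\Sigma)^*$ and $\alpha\in I^*$ let $\nu[\alpha]$ be the sentential form obtained from $\nu$ by replacing each occurrence of a nonterminal $C$ by $C\alpha$. A derivation step replaces one occurrence of a nonterminal $A$ together with its full index string $\alpha\in I^*$: by $\nu[\alpha]$ using a production (1); by $Bf\alpha$ using a production (2); and, if $\alpha=f\alpha'$, by $\nu[\alpha']$ using a production (3). The language generated by $G$ is the set of $u\in\Sigma^*$ that can be derived from $S$ in finitely many steps. $G$ is *linear* if the right-hand side of each production contains at most one occurrence of a nonterminal. A *linear indexed language* is a language generated by a linear indexed grammar. **Linear indexed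 grammars with counters.** An indexed grammar with $k$ counters is defined in the same way, except that each production $\alpha\to\beta$ is replaced by $\alpha\to(\beta,c_1,\dots,c_k)$ with integers $c_i\ge 0$. Sentential forms are $(\nu,n_1,\dots,n_k)$; using such a production rewrites $\nu$ by $\alpha\to\beta$ as above and adds $c_i$ to $n_i$ for every $i$. The generated language is the set of $u\in\Sigma^*$ such that $(u,n_1,\dots,n_k)$ can be derived from $(S,0,\dots,0)$ for some $n_1=\cdots=n_k$. The grammar is *linear* if the indexed grammar obtained by deleting the counter components is linear. **NCM languages.** A one-way nondeterministic $k$-counter machine is a nondeterministic finite automaton with $\lambda$-transitions and $k$ counters holding nonnegative integers, all initially $0$. Each transition depends on the state, on an input letter or $\lambda$, and on which counters are zero; it changes the state and adds $-1$, $0$ or $1$ to each counter (a counter equal to $0$ cannot be decremented). A word is accepted if some computation reads all of it and ends in an accepting state. The machine is $l$-reversal-bounded if in every accepting computation each counter makes at most $l$ changes between non-decreasing and non-increasing. An *NCM language* is a language accepted by an $l$-reversal-bounded $k$-counter machine for some $k,l$. **Proposition.** Let $\Sigma$ be an alphabet and $L\subseteq\Sigma^*$. Then $L$ is generated by a linear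 indexed grammar with $k$ counters for some $k$ if and only if there are an alphabet $\Gamma$, a monoid homomorphism $h:\Gamma^*\to\Sigma^*$, a linear indexed language $L_1\subseteq\Gamma^*$ and an NCM language $L_2\subseteq\Gamma^*$ such that $L=h(L_1\cap L_2)$. -/

import Mathlib

universe u

/-! ### Indexed grammars -/

/-- The productions of an indexed grammar with terminals `T`, nonterminals `N` and indices `I`:
`A → ν`, `A → B f` and `A f → ν`, where `ν` is a word over `N ∪ T`. -/
inductive IndexedRule (T : Type u) (N I : Type) where
  /-- `A → ν` -/
  | rewrite (A : N) (ν : List (Symbol T N))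
  /-- `A → B f` -/
  | push (A B : N) (f : I)
  /-- `A f → ν` -/
  | pop (A : N) (f : I) (ν : List (Symbol T N))

/-- Sentential forms are words in `(N I* ∪ T)*`: every occurrence of a nonterminal carries its own
string of indices, whose head is the top. -/
abbrev SententialForm (T : Type u) (N I : Type) := List (Symbol T (N × List I))

/-- Replace every nonterminal `C` in `ν` by `C α`. -/
def attachIndices {T : Type u} {N I : Type} (α : List I) (ν : List (Symbol T N)) :
    SententialForm T N I :=
  ν.map fun
    | .terminal a => .terminal a
    | .nonterminal C => .nonterminal (C, α)

/-- The number of occurrences of nonterminals in `ν`. -/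
def countNonterminals {T : Type u} {N : Type} (ν : List (Symbol T N)) : ℕ :=
  ν.countP fun
    | .terminal _ => false
    | .nonterminal _ => true

namespace IndexedRule

variable {T : Type u} {N I : Type}

/-- `r.Expands A α w`: the production `r` allows an occurrence of `A α` to be replaced by `w`. -/
inductive Expands : IndexedRule T N I → N → List I → SententialForm T N I → Prop
  | rewrite (A : N) (ν : List (Symbol T N)) (α : List I) :
      Expands (.rewrite A ν) A α (attachIndices α ν)
  | push (A B : N) (f : I) (α : List I) :
      Expands (.push A B f) A α [.nonterminal (B, f :: α)]
  | pop (A : N) (f : I) (ν : List (Symbol T N)) (α : List I) :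
      Expands (.pop A f ν) A (f :: α) (attachIndices α ν)

/-- One application of the production `r` to one occurrence of a nonterminal in `s` yields `s'`. -/
def Rewrites (r : IndexedRule T N I) (s s' : SententialForm T N I) : Prop :=
  ∃ (x y w : SententialForm T N I) (A : N) (α : List I),
    r.Expands A α w ∧ s = x ++ [.nonterminal (A, α)] ++ y ∧ s' = x ++ w ++ y

/-- At most one nonterminal occurs on the right-hand side of the production. -/
def IsLinear : IndexedRule T N I → Prop
  | .rewrite _ ν => countNonterminals ν ≤ 1
  | .push _ _ _ => True
  | .pop _ _ ν => countNonterminals ν ≤ 1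

end IndexedRule

/-- An indexed grammar with terminal alphabet `T`. -/
structure IndexedGrammar (T : Type u) where
  /-- nonterminals -/
  NT : Type
  /-- indices -/
  Index : Type
  finite_nt : Finite NT
  finite_index : Finite Index
  /-- productions -/
  rules : Set (IndexedRule T NT Index)
  finite_rules : rules.Finite
  /-- start nonterminal -/
  initial : NT

namespace IndexedGrammar

variable {T : Type u}

/-- One derivation step `s ⇒ s'`. -/
def Produces (G : IndexedGrammar T) (s s' : SententialForm T G.NT G.Index) : Prop :=
  ∃ r ∈ G.rules, r.Rewrites s s'

/-- The language generated by `G`. -/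
def language (G : IndexedGrammar T) : Language T :=
  {u | Relation.ReflTransGen G.Produces [.nonterminal (G.initial, [])] (u.map .terminal)}

/-- Every right-hand side contains at most one nonterminal. -/
def IsLinear (G : IndexedGrammar T) : Prop :=
  ∀ r ∈ G.rules, r.IsLinear

end IndexedGrammar

/-- `L` is generated by a linear indexed grammar. -/
def IsLinearIndexed {T : Type u} (L : Language T) : Prop :=
  ∃ G : IndexedGrammar T, G.IsLinear ∧ G.language = L

/-! ### Indexed grammars with counters -/

/-- An indexed grammar with `k` (monotonic) counters: each production `α → (β, c₁, …, c_k)` consists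
of a production of an indexed grammar and the amounts that it adds to the counters. -/
structure CounterIndexedGrammar (T : Type u) (k : ℕ) where
  /-- nonterminals -/
  NT : Type
  /-- indices -/
  Index : Type
  finite_nt : Finite NT
  finite_index : Finite Index
  /-- productions -/
  rules : Set (IndexedRule T NT Index × (Fin k → ℕ))
  finite_rules : rules.Finite
  /-- start nonterminal -/
  initial : NT

namespace CounterIndexedGrammar

variable {T : Type u} {k : ℕ}

/-- The underlying indexed grammar: the counter components of the productions are removed. -/
def underlying (G : CounterIndexedGrammar T k) : IndexedGrammar T where
  NT := G.NT
  Index := G.Index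
  finite_nt := G.finite_nt
  finite_index := G.finite_index
  rules := Prod.fst '' G.rules
  finite_rules := G.finite_rules.image _
  initial := G.initial

/-- One derivation step `(s, n₁, …, n_k) ⇒ (s', n₁ + c₁, …, n_k + c_k)`. -/
def Produces (G : CounterIndexedGrammar T k)
    (p p' : SententialForm T G.NT G.Index × (Fin k → ℕ)) : Prop :=
  ∃ r ∈ G.rules, r.1.Rewrites p.1 p'.1 ∧ p'.2 = p.2 + r.2

/-- The language generated by `G`: the terminal words that are derived with all counters equal. -/
def language (G : CounterIndexedGrammar T k) : Language T :=
  {u | ∃ n : Fin k → ℕ,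
    Relation.ReflTransGen G.Produces ([.nonterminal (G.initial, [])], 0) (u.map .terminal, n) ∧
      ∀ i j, n i = n j}

/-- `G` is linear if its underlying grammar is. -/
def IsLinear (G : CounterIndexedGrammar T k) : Prop :=
  G.underlying.IsLinear

end CounterIndexedGrammar

/-- `L` is generated by a linear indexed grammar with some number of counters. -/
def IsLinearIndexedWithCounters {T : Type u} (L : Language T) : Prop :=
  ∃ (k : ℕ) (G : CounterIndexedGrammar T k), G.IsLinear ∧ G.language = L

/-! ### Reversal-bounded multicounter machines -/

/-- A one-way nondeterministic machine with `k` counters. In a given state, reading an input letter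
(`some a`) or nothing (`none`), and seeing which counters are zero (`true` means zero), it may go
to a new state and add `-1`, `0` or `1` to each counter. -/
structure CounterMachine (T : Type u) (k : ℕ) where
  /-- states -/
  State : Type
  finite_state : Finite State
  /-- transition relation -/
  step : State → Option T → (Fin k → Bool) → Set (State × (Fin k → SignType))
  /-- initial state -/
  start : State
  /-- accepting states -/
  accept : Set State

/-- The number of changes of direction in a sequence of counter updates, where `s` (`1` for
non-decreasing, `-1` for non-increasing) is the direction before the sequence. An update by `0`
changes no direction. -/
def reversalsFrom (s : SignType) : List SignType → ℕ
  | [] => 0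
  | d :: ds => if d = 0 ∨ d = s then reversalsFrom s ds else reversalsFrom d ds + 1

namespace CounterMachine

variable {T : Type u} {k : ℕ}

/-- `M.Computes q c w ds q' c'`: there is a computation from state `q` with counter values `c` to
state `q'` with counter values `c'` that reads `w` and whose steps make the counter updates `ds`.
Counter values are natural numbers, so a counter that is zero cannot be decremented. -/
inductive Computes (M : CounterMachine T k) :
    M.State → (Fin k → ℕ) → List T → List (Fin k → SignType) → M.State → (Fin k → ℕ) → Prop
  | refl (q : M.State) (c : Fin k → ℕ) : Computes M q c [] [] q c
  | step {q q' q'' : M.State} {c c' c'' : Fin k → ℕ} {a : Option T} {w : List T}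
      {d : Fin k → SignType} {ds : List (Fin k → SignType)}
      (htrans : (q', d) ∈ M.step q a (fun i => decide (c i = 0)))
      (hupdate : ∀ i, (c' i : ℤ) = (c i : ℤ) + (d i : ℤ))
      (hrest : Computes M q' c' w ds q'' c'') :
      Computes M q c (a.toList ++ w) (d :: ds) q'' c''

/-- The words accepted by `M`, starting with all counters zero, by final state. -/
def language (M : CounterMachine T k) : Language T :=
  {w | ∃ ds q c, M.Computes M.start 0 w ds q c ∧ q ∈ M.accept}

/-- In every accepting computation each counter makes at most `l` changes between non-decreasing
and non-increasing. (All counters start at zero, hence in non-decreasing mode.) -/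
def IsReversalBounded (M : CounterMachine T k) (l : ℕ) : Prop :=
  ∀ w ds q c, M.Computes M.start 0 w ds q c → q ∈ M.accept →
    ∀ i, reversalsFrom 1 (ds.map fun d => d i) ≤ l

end CounterMachine

/-- `L` is accepted by a one-way nondeterministic `l`-reversal-bounded `k`-counter machine, for
some `k` and `l`. -/
def IsNCM {T : Type u} (L : Language T) : Prop :=
  ∃ (k l : ℕ) (M : CounterMachine T k), M.IsReversalBounded l ∧ M.language = L

/-! ### Homomorphic images -/

/-- The image `h(L)` of a language under a homomorphism of free monoids. -/
def homImage {Γ T : Type u} (h : FreeMonoid Γ →* FreeMonoid T) (L : Language Γ) : Language T :=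
  {w | ∃ v ∈ L, (h (FreeMonoid.ofList v)).toList = w}

/-! Counters of a grammar, letters of a word and weights of automaton transitions are three ways of
recording the same sums, and both directions pass between them.

Given a grammar with counters, let every production emit `c i` copies of a new letter for counter
`i` instead of adding `c i`. The resulting language `L₁` is linear indexed, `h` deletes the new
letters, and `L₂` consists of the words in which all new letters occur equally often. A machine
accepts `L₂` with one reversal: it counts the letters, then decrements all counters together.

Conversely, the machine for `L₂` is turned into a finite automaton without zero tests whose
transitions carry vectors in `ℕ^K` and which accepts when all components of the sum agree
(`IsNCM.exists_weightedAutomaton`). If a counter makes at most `l` reversals, its history splits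
into at most `2 * l + 2` segments on which it is monotone and either always zero or always positive.
A monotone stretch has constant status once both of its ends have that status. So all zero tests
reduce to finitely many conditions on the values at the ends of segments, each value being
increments minus decrements. Nondeterministic padding after acceptance turns these conditions into
equality of all components.

This automaton is then combined with the linear grammar for `L₁` by a triple construction. A linear
sentential form has at most one nonterminal, so a run can be guessed from both ends inwards around
it, with the weights added to the counters. Addition is commutative, so the order of the
contributions is irrelevant (`AutomatonProduct.language_grammar`). -/

section

variable {T : Type u} {N I : Type}

/-! ### Words with at most one nonterminal and their index strings -/

theorem countNonterminals_terminals_append (v : List T) (ν : List (Symbol T N)) :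
    countNonterminals (v.map .terminal ++ ν) = countNonterminals ν := by
  simp [countNonterminals, List.countP_append, List.countP_map, List.countP_eq_zero]

theorem countNonterminals_nonterminal_cons (A : N) (ν : List (Symbol T N)) :
    countNonterminals (.nonterminal A :: ν) = countNonterminals ν + 1 :=
  List.countP_cons_of_pos rfl

theorem countNonterminals_terminals (v : List T) :
    countNonterminals (v.map .terminal : List (Symbol T N)) = 0 := by
  simp [countNonterminals, List.countP_map, List.countP_eq_zero]

theorem exists_eq_terminals {ν : List (Symbol T N)} (h : countNonterminals ν = 0) :
    ∃ v : List T, ν = v.map .terminal := by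
  induction ν with
  | nil => exact ⟨[], rfl⟩
  | cons x ν ih =>
    cases x with
    | terminal a =>
      obtain ⟨v, rfl⟩ := ih h
      exact ⟨a :: v, rfl⟩
    | nonterminal A => rw [countNonterminals_nonterminal_cons] at h; omega

theorem attachIndices_append (α : List I) (μ ν : List (Symbol T N)) :
    attachIndices α (μ ++ ν) = attachIndices α μ ++ attachIndices α ν :=
  List.map_append

theorem attachIndices_terminals (α : List I) (v : List T) :
    attachIndices α (v.map .terminal : List (Symbol T N)) = v.map .terminal := by
  simp [attachIndices, Function.comp_def]

end

/-! ### Leftmost derivations -/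

namespace CounterIndexedGrammar

variable {T : Type u} {k : ℕ}

/-- `G.Generates s v n`: a leftmost derivation leads from the sentential form `s` to the terminal
word `v` and adds `n` to the counters. -/
inductive Generates (G : CounterIndexedGrammar T k) :
    SententialForm T G.NT G.Index → List T → (Fin k → ℕ) → Prop
  | nil : Generates G [] [] 0
  | terminal (a : T) {s : SententialForm T G.NT G.Index} {v : List T} {n : Fin k → ℕ}
      (h : Generates G s v n) : Generates G (.terminal a :: s) (a :: v) n
  | nonterminal {r : IndexedRule T G.NT G.Index × (Fin k → ℕ)} (hr : r ∈ G.rules) {A : G.NT}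
      {α : List G.Index} {w s : SententialForm T G.NT G.Index} {v : List T} {n : Fin k → ℕ}
      (hw : r.1.Expands A α w) (h : Generates G (w ++ s) v n) :
      Generates G (.nonterminal (A, α) :: s) v (r.2 + n)

namespace Generates

variable {G : CounterIndexedGrammar T k}

theorem of_terminals (v : List T) : G.Generates (v.map .terminal) v 0 := by
  induction v with
  | nil => exact .nil
  | cons a v ih => exact .terminal a ih

theorem append {s s' : SententialForm T G.NT G.Index} {v v' : List T} {n n' : Fin k → ℕ}
    (h : G.Generates s v n) (h' : G.Generates s' v' n') :
    G.Generates (s ++ s') (v ++ v') (n + n') := by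
  induction h with
  | nil => simpa using h'
  | terminal a _ ih => exact .terminal a ih
  | nonterminal hr hw _ ih =>
    rw [add_assoc]
    exact .nonterminal hr hw (by simpa using ih)

theorem eq_of_terminals {v w : List T} {n : Fin k → ℕ}
    (h : G.Generates (v.map .terminal) w n) : w = v ∧ n = 0 := by
  induction v generalizing w with
  | nil => cases h; exact ⟨rfl, rfl⟩
  | cons a v ih =>
    cases h with
    | terminal _ h => obtain ⟨rfl, rfl⟩ := ih h; exact ⟨rfl, rfl⟩

theorem of_expands {G : CounterIndexedGrammar T 0} {r : IndexedRule T G.NT G.Index}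
    {n : Fin 0 → ℕ} (hr : (r, n) ∈ G.rules) {A : G.NT} {α : List G.Index}
    {w s : SententialForm T G.NT G.Index} {v : List T} (hw : r.Expands A α w)
    (h : G.Generates (w ++ s) v 0) : G.Generates (.nonterminal (A, α) :: s) v 0 := by
  have := Generates.nonterminal hr hw h
  rwa [Subsingleton.elim ((r, n).2 + 0) 0] at this

/-- A step at a later nonterminal commutes with the leftmost step, since each occurrence carries its
own indices and increments commute. It can be postponed until its nonterminal is leftmost. -/
theorem of_rewrites {r : IndexedRule T G.NT G.Index × (Fin k → ℕ)} (hr : r ∈ G.rules)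
    {t s : SententialForm T G.NT G.Index} {v : List T} {n : Fin k → ℕ}
    (h : G.Generates t v n) (hst : r.1.Rewrites s t) : G.Generates s v (r.2 + n) := by
  obtain ⟨x, y, w, A, α, hw, rfl, ht⟩ := hst
  induction h generalizing x with
  | nil =>
    cases x with
    | nil => exact .nonterminal (s := y) hr hw (ht ▸ .nil)
    | cons => simp at ht
  | @terminal a s v n h ih =>
    cases x with
    | nil => exact .nonterminal (s := y) hr hw (ht ▸ .terminal a h)
    | cons b x =>
      simp only [List.cons_append, List.cons.injEq] at ht
      obtain ⟨rfl, ht⟩ := ht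
      exact .terminal a (ih x ht)
  | @nonterminal r' hr' B β w' s v n hw' h ih =>
    cases x with
    | nil =>
      exact .nonterminal (s := y) hr hw (ht ▸ .nonterminal hr' hw' h)
    | cons b x =>
      simp only [List.cons_append, List.cons.injEq] at ht
      obtain ⟨rfl, ht⟩ := ht
      rw [add_left_comm]
      refine .nonterminal hr' hw' ?_
      simpa using ih (w' ++ x) (by simp [ht])

theorem reflTransGen {s : SententialForm T G.NT G.Index} {v : List T} {n : Fin k → ℕ}
    (h : G.Generates s v n) (x : SententialForm T G.NT G.Index) (m : Fin k → ℕ) :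
    Relation.ReflTransGen G.Produces (x ++ s, m) (x ++ v.map .terminal, m + n) := by
  induction h generalizing x m with
  | nil => exact add_zero m ▸ .refl
  | terminal a _ ih =>
    have := ih (x ++ [.terminal a]) m
    rwa [List.append_assoc, List.append_assoc] at this
  | @nonterminal r hr A α w s v n hw h ih =>
    refine .head (b := (x ++ w ++ s, m + r.2))
      ⟨r, hr, ⟨x, s, w, A, α, hw, by simp, rfl⟩, rfl⟩ ?_
    simpa [add_assoc] using ih x (m + r.2)

end Generates

theorem generates_of_reflTransGen {G : CounterIndexedGrammar T k}
    {p : SententialForm T G.NT G.Index × (Fin k → ℕ)} {v : List T} {n : Fin k → ℕ}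
    (h : Relation.ReflTransGen G.Produces p (v.map .terminal, n)) :
    ∃ n', G.Generates p.1 v n' ∧ n = p.2 + n' := by
  induction h using Relation.ReflTransGen.head_induction_on with
  | refl => exact ⟨0, .of_terminals v, rfl⟩
  | head hp _ ih =>
    obtain ⟨r, hr, hrw, hc⟩ := hp
    obtain ⟨n', hn', rfl⟩ := ih
    exact ⟨r.2 + n', .of_rewrites hr hn' hrw, by rw [hc, add_assoc]⟩

theorem mem_language_iff {G : CounterIndexedGrammar T k} {u : List T} :
    u ∈ G.language ↔
      ∃ n, G.Generates [.nonterminal (G.initial, [])] u n ∧ ∀ i j, n i = n j := by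
  constructor
  · rintro ⟨n, h, hn⟩
    obtain ⟨n', h', rfl⟩ := generates_of_reflTransGen h
    exact ⟨n', h', by simpa using hn⟩
  · rintro ⟨n, h, hn⟩
    exact ⟨n, by simpa using h.reflTransGen [] 0, hn⟩

theorem language_underlying (G : CounterIndexedGrammar T 0) :
    G.underlying.language = G.language := by
  ext u
  constructor
  · intro h
    refine ⟨0, ?_, fun i => i.elim0⟩
    refine Relation.ReflTransGen.lift (p := G.Produces)
      (fun s => ((s, 0) : _ × (Fin 0 → ℕ))) ?_ _ _ h
    rintro s s' ⟨_, ⟨r, hr, rfl⟩, hrw⟩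
    exact ⟨r, hr, hrw, Subsingleton.elim _ _⟩
  · rintro ⟨n, h, -⟩
    refine Relation.ReflTransGen.lift (p := G.underlying.Produces) Prod.fst ?_ _ _ h
    rintro p p' ⟨r, hr, hrw, -⟩
    exact ⟨r.1, ⟨r, hr, rfl⟩, hrw⟩

end CounterIndexedGrammar

/-- With zero counters the balance condition is vacuous, so the calculus of leftmost derivations
also covers grammars without counters. -/
theorem isLinearIndexed_iff {T : Type u} {L : Language T} :
    IsLinearIndexed L ↔ ∃ G : CounterIndexedGrammar T 0, G.IsLinear ∧ G.language = L := by
  constructor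
  · rintro ⟨⟨N, I, hN, hI, R, hR, S⟩, hG, rfl⟩
    let G : CounterIndexedGrammar T 0 := ⟨N, I, hN, hI, (·, 0) '' R, hR.image _, S⟩
    have hu : G.underlying = ⟨N, I, hN, hI, R, hR, S⟩ := by
      simp [CounterIndexedGrammar.underlying, G, Set.image_image]
    exact ⟨G, show G.underlying.IsLinear from hu ▸ hG, by rw [← G.language_underlying, hu]⟩
  · rintro ⟨G, hG, rfl⟩
    exact ⟨G.underlying, hG, G.language_underlying⟩

/-! ### Turning counters into letters -/

namespace CounterLetters

variable {T : Type u} {k : ℕ}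

/-- The letters of `T` together with one letter for each counter. -/
abbrev Letter (T : Type u) (k : ℕ) : Type u := T ⊕ ULift.{u} (Fin k)

/-- The word obtained by deleting the counter letters. -/
def erase (v : List (Letter T k)) : List T := v.filterMap Sum.getLeft?

/-- The number of occurrences of each counter letter. -/
def tally (v : List (Letter T k)) (i : Fin k) : ℕ := 
  (v.filterMap (Sum.elim (fun _ => none) fun j => some j.down)).count i

/-- A word without letters of `T` in which the `i`-th counter letter occurs `c i` times. -/
def emit (T : Type u) (c : Fin k → ℕ) : List (Letter T k) :=
  (List.finRange k).flatMap fun i => List.replicate (c i) (.inr ⟨i⟩)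

theorem erase_append (v w : List (Letter T k)) : erase (v ++ w) = erase v ++ erase w :=
  List.filterMap_append

theorem tally_append (v w : List (Letter T k)) : tally (v ++ w) = tally v + tally w := by
  funext i; simp [tally]

theorem erase_emit (c : Fin k → ℕ) : erase (emit T c) = [] := by
  simp only [erase, emit, List.filterMap_eq_nil_iff, List.mem_flatMap]
  rintro a ⟨i, -, hi⟩
  rw [List.eq_of_mem_replicate hi]
  rfl

theorem tally_emit (c : Fin k → ℕ) : tally (emit T c) = c := by
  funext j
  have : 
      (emit T c).filterMap (Sum.elim (fun _ => none) fun j => some j.down) =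
        (List.finRange k).flatMap fun i => List.replicate (c i) i := by
    simp [emit, List.filterMap_flatMap, List.filterMap_replicate]
  rw [tally, this, List.count_flatMap]
  have h : (List.count j ∘ fun i => List.replicate (c i) i) =
      fun i => if i = j then c j else 0 := by
    funext i
    by_cases h : i = j <;> simp [List.count_replicate, h]
  rw [h, ← Fin.sum_univ_def]
  simp

/-! ### The grammar that emits counter letters -/

variable {N I : Type}

/-- Nonterminals of the grammar that emits counter letters: those of the original grammar, and
those which are about to push an index. -/
abbrev NT (N I : Type) : Type := N ⊕ N × I

/-- The embedding of the symbols of the original grammar. -/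
def symbol (k : ℕ) (I : Type) : Symbol T N → Symbol (Letter T k) (NT N I)
  | .terminal a => .terminal (.inl a)
  | .nonterminal A => .nonterminal (.inl A)

/-- The embedding of sentential forms of the original grammar. -/
def lift (k : ℕ) (s : SententialForm T N I) : SententialForm (Letter T k) (NT N I) I :=
  s.map fun
    | .terminal a => .terminal (.inl a)
    | .nonterminal (A, α) => .nonterminal (.inl A, α)

/-- The sentential form of the original grammar: counter letters are deleted and pending pushes
are carried out. -/
def proj (s : SententialForm (Letter T k) (NT N I) I) : SententialForm T N I :=
  s.filterMap fun
    | .terminal (.inl a) => some (.terminal a)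
    | .terminal (.inr _) => none
    | .nonterminal (.inl A, α) => some (.nonterminal (A, α))
    | .nonterminal (.inr (A, f), α) => some (.nonterminal (A, f :: α))

/-- The number of occurrences of each counter letter in a sentential form. -/
def formTally (s : SententialForm (Letter T k) (NT N I) I) : Fin k → ℕ :=
  tally (s.filterMap fun
    | .terminal a => some a
    | .nonterminal _ => none)

/-- The production that emits counter letters instead of increasing the counters. -/
def rule : IndexedRule T N I × (Fin k → ℕ) → IndexedRule (Letter T k) (NT N I) I
  | (.rewrite A ν, c) => .rewrite (.inl A) ((emit T c).map .terminal ++ ν.map (symbol k I))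
  -- A push production has no room for terminals: the letters are emitted first, and the nonterminal
  -- `(B, f)` remembers the push.
  | (.push A B f, c) => .rewrite (.inl A) ((emit T c).map .terminal ++ [.nonterminal (.inr (B, f))])
  | (.pop A f ν, c) => .pop (.inl A) f ((emit T c).map .terminal ++ ν.map (symbol k I))

/-- The grammar that emits counter letters instead of increasing the counters. -/
abbrev grammar (G : CounterIndexedGrammar T k) : CounterIndexedGrammar (Letter T k) 0 where
  NT := NT G.NT G.Index
  Index := G.Index
  finite_nt := have := G.finite_nt; have := G.finite_index; inferInstance
  finite_index := G.finite_index
  rules := (fun r => (rule r, 0)) '' G.rules ∪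
    Set.range fun x : G.NT × G.Index => (.push (.inr x) (.inl x.1) x.2, 0)
  finite_rules := have := G.finite_nt; have := G.finite_index
    (G.finite_rules.image _).union (Set.finite_range _)
  initial := .inl G.initial

theorem countNonterminals_symbol (ν : List (Symbol T N)) :
    countNonterminals (ν.map (symbol k I)) = countNonterminals ν := by
  rw [countNonterminals, countNonterminals, List.countP_map]
  congr 1
  funext x
  cases x <;> rfl

theorem grammar_isLinear {G : CounterIndexedGrammar T k} (hG : G.IsLinear) :
    (grammar G).IsLinear := by
  rintro _ ⟨_, ⟨⟨r, c⟩, hr, rfl⟩ | ⟨x, rfl⟩, rfl⟩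
  · have := hG r ⟨(r, c), hr, rfl⟩
    cases r with
    | rewrite A ν =>
      exact ((countNonterminals_terminals_append _ _).trans (countNonterminals_symbol _)).trans_le
        this
    | push A B f => exact (countNonterminals_terminals_append _ _).trans_le le_rfl
    | pop A f ν =>
      exact ((countNonterminals_terminals_append _ _).trans (countNonterminals_symbol _)).trans_le
        this
  · trivial

theorem attachIndices_symbol (α : List I) (ν : List (Symbol T N)) :
    attachIndices α (ν.map (symbol k I)) = lift k (attachIndices α ν) := by
  simp only [attachIndices, lift, List.map_map]
  refine List.map_congr_left fun x _ => ?_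
  cases x <;> rfl

theorem proj_append (s t : SententialForm (Letter T k) (NT N I) I) :
    proj (s ++ t) = proj s ++ proj t :=
  List.filterMap_append

theorem proj_terminals (v : List (Letter T k)) :
    proj (v.map .terminal : SententialForm (Letter T k) (NT N I) I) =
      (erase v).map .terminal := by
  induction v with
  | nil => rfl
  | cons a v ih => cases a with
    | inl a => exact congrArg (List.cons (.terminal a)) ih
    | inr i => exact ih

theorem proj_lift (s : SententialForm T N I) : proj (lift k s) = s := by
  induction s with
  | nil => rfl
  | cons x s ih => rcases x with a | A <;> simpa [proj, lift] using ih

theorem formTally_append (s t : SententialForm (Letter T k) (NT N I) I) :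
    formTally (s ++ t) = formTally s + formTally t := by
  simp [formTally, tally_append]

theorem formTally_terminals (v : List (Letter T k)) :
    formTally (v.map .terminal : SententialForm (Letter T k) (NT N I) I) = tally v := by
  simp [formTally, List.filterMap_map]

theorem formTally_lift (s : SententialForm T N I) : formTally (lift k s) = 0 := by
  induction s with
  | nil => rfl
  | cons x s ih => funext i; rcases x with a | A <;> exact congrFun ih i

theorem exists_of_expands_rule {r : IndexedRule T N I} {c : Fin k → ℕ} {A : NT N I} {α : List I}
    {w : SententialForm (Letter T k) (NT N I) I} (h : (rule (r, c)).Expands A α w) :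
    ∃ B w', A = .inl B ∧ r.Expands B α w' ∧ proj w = w' ∧ formTally w = c := by
  cases r with
  | rewrite B ν =>
    cases h
    refine ⟨B, _, rfl, .rewrite B ν α, ?_, ?_⟩
    · rw [attachIndices_append, attachIndices_terminals, attachIndices_symbol, proj_append,
        proj_terminals, erase_emit, proj_lift]
      rfl
    · rw [attachIndices_append, attachIndices_terminals, attachIndices_symbol, formTally_append,
        formTally_terminals, tally_emit, formTally_lift, add_zero]
  | push B C f =>
    cases h
    refine ⟨B, _, rfl, .push B C f α, ?_, ?_⟩
    · rw [attachIndices_append, attachIndices_terminals, proj_append, proj_terminals, erase_emit]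
      rfl
    · rw [attachIndices_append, attachIndices_terminals, formTally_append,
        formTally_terminals, tally_emit]
      exact add_zero c
  | pop B f ν =>
    cases h with
    | pop _ _ _ α =>
    refine ⟨B, _, rfl, .pop B f ν α, ?_, ?_⟩
    · rw [attachIndices_append, attachIndices_terminals, attachIndices_symbol, proj_append,
        proj_terminals, erase_emit, proj_lift]
      rfl
    · rw [attachIndices_append, attachIndices_terminals, attachIndices_symbol, formTally_append,
        formTally_terminals, tally_emit, formTally_lift, add_zero]

variable {G : CounterIndexedGrammar T k}

/-- Under `proj` a step of the emitting grammar becomes a step of `G`, or no step at all if it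
carries out a pending push. `formTally` accounts for the letters already present in the form. -/
theorem generates_proj {s : SententialForm (Letter T k) (grammar G).NT (grammar G).Index}
    {v : List (Letter T k)} {m : Fin 0 → ℕ} (h : (grammar G).Generates s v m) :
    ∃ n, G.Generates (proj s) (erase v) n ∧ tally v = formTally s + n := by
  induction h with
  | nil => exact ⟨0, .nil, rfl⟩
  | @terminal a s v _ _ ih =>
    obtain ⟨n, hn, ht⟩ := ih
    refine ⟨n, ?_, ?_⟩
    · cases a with
      | inl a => exact .terminal a hn
      | inr i => exact hn
    · have h₁ : tally (a :: v) = tally [a] + tally v := tally_append [a] v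
      have h₂ : formTally (.terminal a :: s) = formTally [.terminal a] + formTally s :=
        formTally_append [.terminal a] s
      rw [h₁, h₂, ht, add_assoc]
      rfl
  | @nonterminal r hr A α w s v _ hw _ ih =>
    obtain ⟨n, hn, ht⟩ := ih
    rcases hr with ⟨⟨r, c⟩, hr, rfl⟩ | ⟨⟨B, f⟩, rfl⟩
    · obtain ⟨B, w', rfl, hw', rfl, rfl⟩ := exists_of_expands_rule hw
      rw [formTally_append] at ht
      rw [proj_append] at hn
      refine ⟨formTally w + n, .nonterminal hr hw' hn, ?_⟩
      rw [ht, ← add_assoc, add_comm (formTally w)]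
      rfl
    · cases hw
      exact ⟨n, hn, ht⟩

theorem exists_generates_lift {s : SententialForm T G.NT G.Index} {v : List T} {n : Fin k → ℕ}
    (h : G.Generates s v n) :
    ∃ w, (grammar G).Generates (lift k s) w 0 ∧ erase w = v ∧ tally w = n := by
  induction h with
  | nil => exact ⟨[], .nil, rfl, rfl⟩
  | terminal a _ ih =>
    obtain ⟨w, hw, rfl, rfl⟩ := ih
    exact ⟨.inl a :: w, .terminal _ hw, rfl, rfl⟩
  | @nonterminal r hr A α t s v n ht _ ih =>
    obtain ⟨w, hw, rfl, rfl⟩ := ih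
    refine ⟨emit T r.2 ++ w, ?_, by rw [erase_append, erase_emit, List.nil_append],
      by rw [tally_append, tally_emit]⟩
    obtain ⟨r, c⟩ := r
    have hr' : (rule (r, c), 0) ∈ (grammar G).rules := .inl ⟨(r, c), hr, rfl⟩
    have key (x : SententialForm (Letter T k) (NT G.NT G.Index) G.Index)
        (h : (grammar G).Generates x w 0) :
        (grammar G).Generates ((emit T c).map .terminal ++ x) (emit T c ++ w) 0 :=
      (CounterIndexedGrammar.Generates.of_terminals (G := grammar G) _).append h
    have hlift : lift k (t ++ s) = lift k t ++ lift k s := List.map_append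
    rw [hlift] at hw
    cases ht with
    | rewrite A ν α =>
      refine .nonterminal (n := 0) hr' (.rewrite _ _ _) ?_
      rw [attachIndices_append, attachIndices_terminals, attachIndices_symbol, List.append_assoc]
      exact key _ hw
    | push A B f α =>
      refine .nonterminal (n := 0) hr' (.rewrite _ _ _) ?_
      rw [attachIndices_append, attachIndices_terminals, List.append_assoc]
      exact key _ (.nonterminal (G := grammar G) (n := 0) (r := (.push (.inr (B, f)) (.inl B) f, 0))
        (.inr ⟨(B, f), rfl⟩) (.push _ _ _ _) hw)
    | pop A f ν α =>
      refine .nonterminal (n := 0) hr' (.pop _ _ _ _) ?_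
      rw [attachIndices_append, attachIndices_terminals, attachIndices_symbol, List.append_assoc]
      exact key _ hw

theorem mem_language_iff {u : List T} :
    u ∈ G.language ↔
      ∃ v ∈ (grammar G).language, (∀ i j, tally v i = tally v j) ∧ erase v = u := by
  rw [CounterIndexedGrammar.mem_language_iff]
  constructor
  · rintro ⟨n, h, hn⟩
    obtain ⟨w, hw, rfl, rfl⟩ := exists_generates_lift h
    exact ⟨w, CounterIndexedGrammar.mem_language_iff.2 ⟨0, hw, fun i => i.elim0⟩, hn, rfl⟩
  · rintro ⟨v, hv, ht, rfl⟩
    obtain ⟨m, hm, -⟩ := CounterIndexedGrammar.mem_language_iff.1 hv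
    obtain ⟨n, hn, h⟩ := generates_proj hm
    have h' : tally v = n := h.trans (zero_add n)
    exact ⟨n, hn, h' ▸ ht⟩

/-! ### The machine comparing the numbers of counter letters -/

/-- The phases of the machine: reading the input, emptying the counters, accepting. -/
inductive Phase
  | read
  | empty
  | done

instance : Finite Phase :=
  Finite.of_surjective (fun i : Fin 3 => match i with | 0 => Phase.read | 1 => .empty | 2 => .done)
    fun p => by cases p; exacts [⟨0, rfl⟩, ⟨1, rfl⟩, ⟨2, rfl⟩]

/-- The machine that accepts the words with equally many occurrences of all counter letters: it
counts them and then decrements all counters simultaneously until all are zero. -/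
abbrev machine (T : Type u) (k : ℕ) : CounterMachine (Letter T k) k where
  State := Phase
  finite_state := inferInstance
  step
    | .read, some (.inl _), _ => {(.read, 0)}
    | .read, some (.inr i), _ => {(.read, Pi.single i.down 1)}
    | .read, none, _ => {(.empty, 0)}
    | .empty, none, z => {x | x = (.empty, -1) ∧ ∀ i, z i = false} ∪
        {x | x = (.done, 0) ∧ ∀ i, z i = true}
    | _, _, _ => ∅
  start := .read
  accept := {.done}

theorem reversalsFrom_nonpos {s : SignType} {ds : List SignType} (h : ∀ d ∈ ds, d = 0 ∨ d = -1) :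
    reversalsFrom s ds ≤ if s = -1 then 0 else 1 := by
  induction ds generalizing s with
  | nil => simp [reversalsFrom]
  | cons d ds ih =>
    rw [List.forall_mem_cons] at h
    rw [reversalsFrom]
    split_ifs with h₁ h₂ h₂
    · exact (ih h.2).trans (by simp [h₂])
    · exact (ih h.2).trans (by simp [h₂])
    · rcases h.1 with h | h <;> simp_all
    · rcases h.1 with h' | rfl
      · simp_all
      · have := ih (s := -1) h.2
        simp_all

theorem of_computes_done {c c' : Fin k → ℕ} {w : List (Letter T k)} {ds : List (Fin k → SignType)}
    {p q : (machine T k).State}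
    (h : (machine T k).Computes p c w ds q c') (hp : p = .done) : w = [] ∧ ds = [] := by
  cases h with
  | refl => exact ⟨rfl, rfl⟩
  | step h => subst hp; simp at h

/-- Simultaneous decrements preserve the differences of the counters, and this phase can be left
only when all of them are zero. -/
theorem of_computes_empty {p : (machine T k).State} {c c' : Fin k → ℕ} {w : List (Letter T k)}
    {ds : List (Fin k → SignType)} (h : (machine T k).Computes p c w ds Phase.done c')
    (hp : p = .empty) :
    w = [] ∧ (∀ i j, c i = c j) ∧ ∀ d ∈ ds, ∀ i, d i = 0 ∨ d i = -1 := by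
  generalize hq : (Phase.done : (machine T k).State) = q at h
  induction h with
  | refl => simp_all
  | @step p q q' c c' c'' a w d ds ht hu hr ih =>
    subst hp hq
    cases a with
    | some a => simp [machine] at ht
    | none =>
      simp only [machine, Set.mem_union, Set.mem_ofPred_eq, Prod.mk.injEq, decide_eq_false_iff_not,
        decide_eq_true_eq] at ht
      rcases ht with ⟨⟨rfl, rfl⟩, hz⟩ | ⟨⟨rfl, rfl⟩, hz⟩
      · obtain ⟨rfl, h₁, h₂⟩ := ih rfl rfl
        refine ⟨rfl, fun i j => ?_, ?_⟩
        · have hi := hu i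
          have hj := hu j
          have := h₁ i j
          simp at hi hj
          omega
        · rw [List.forall_mem_cons]
          exact ⟨fun i => .inr rfl, h₂⟩
      · obtain ⟨rfl, rfl⟩ := of_computes_done hr rfl
        exact ⟨rfl, fun i j => by rw [hz, hz], by simp⟩

theorem of_computes_read {p : (machine T k).State} {c c' : Fin k → ℕ} {w : List (Letter T k)}
    {ds : List (Fin k → SignType)} (h : (machine T k).Computes p c w ds Phase.done c')
    (hp : p = .read) :
    (∀ i j, c i + tally w i = c j + tally w j) ∧
      ∀ i, reversalsFrom 1 (ds.map fun d => d i) ≤ 1 := by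
  generalize hq : (Phase.done : (machine T k).State) = q at h
  induction h with
  | refl => simp_all
  | @step p q q' c c' c'' a w d ds ht hu hr ih =>
    subst hp hq
    rcases a with - | a | ⟨⟨l⟩⟩
    · simp only [machine, Set.mem_singleton_iff, Prod.mk.injEq] at ht
      obtain ⟨rfl, rfl⟩ := ht
      obtain ⟨rfl, h₁, h₂⟩ := of_computes_empty hr rfl
      have hc : c' = c := by
        funext i
        simpa using hu i
      subst hc
      refine ⟨fun i j => by rw [h₁ i j]; rfl, fun i => ?_⟩
      have := reversalsFrom_nonpos (s := 1) (ds := ds.map fun d => d i)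
        (by simpa using fun d hd => h₂ d hd i)
      simpa [reversalsFrom] using this
    · simp only [machine, Set.mem_singleton_iff, Prod.mk.injEq] at ht
      obtain ⟨rfl, rfl⟩ := ht
      obtain ⟨h₁, h₂⟩ := ih rfl rfl
      have hc : c' = c := by
        funext i
        simpa using hu i
      subst hc
      exact ⟨h₁, fun i => by simpa [reversalsFrom] using h₂ i⟩
    · simp only [machine, Set.mem_singleton_iff, Prod.mk.injEq] at ht
      obtain ⟨rfl, rfl⟩ := ht
      obtain ⟨h₁, h₂⟩ := ih rfl rfl
      have hc (i) : c' i = c i + tally [(.inr ⟨l⟩ : Letter T k)] i := by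
        have := hu i
        by_cases hi : i = l
        · subst hi
          simp [tally] at this ⊢
          exact_mod_cast this
        · have hi' : l ≠ i := Ne.symm hi
          simp [tally, hi, hi'] at this ⊢
          exact this
      refine ⟨fun i j => ?_, fun i => ?_⟩
      · have := h₁ i j
        rw [hc, hc] at this
        have ht : tally (.inr ⟨l⟩ :: w) = tally [(.inr ⟨l⟩ : Letter T k)] + tally w :=
          tally_append [_] w
        simpa [ht, add_assoc] using this
      · have hs : (Pi.single l 1 : Fin k → SignType) i = 0 ∨
            (Pi.single l 1 : Fin k → SignType) i = 1 := by
          by_cases hi : i = l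
          · subst hi; simp
          · simp [hi]
        simpa [reversalsFrom, hs] using h₂ i

theorem computes_empty (n : ℕ) : ∃ ds,
    (machine T k).Computes Phase.empty (fun _ => n) [] ds Phase.done (fun _ => 0) := by
  induction n with
  | zero =>
    exact ⟨[0], .step (M := machine T k) (q := Phase.empty) (d := 0) (a := none) (q' := Phase.done) (c' := fun _ => 0) (.inr ⟨rfl, by simp⟩)
      (by simp) (.refl _ _)⟩
  | succ n ih =>
    obtain ⟨ds, h⟩ := ih
    exact ⟨-1 :: ds, .step (M := machine T k) (q := Phase.empty) (d := -1) (a := none) (q' := Phase.empty) (c' := fun _ => n) (.inl ⟨rfl, by simp⟩)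
      (by simp) h⟩

theorem computes_read {n : ℕ} (w : List (Letter T k)) (c : Fin k → ℕ)
    (h : ∀ i, c i + tally w i = n) : ∃ ds,
    (machine T k).Computes Phase.read c w ds Phase.done (fun _ => 0) := by
  induction w generalizing c with
  | nil =>
    obtain ⟨ds, hds⟩ := computes_empty (T := T) (k := k) n
    obtain rfl : c = fun _ => n := funext h
    exact ⟨0 :: ds, .step (M := machine T k) (q := Phase.read) (d := 0) (a := none) (q' := Phase.empty) (c' := fun _ => n) rfl (by simp) hds⟩
  | cons a w ih =>
    rcases a with a | ⟨⟨l⟩⟩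
    · obtain ⟨ds, hds⟩ := ih c h
      exact ⟨0 :: ds, .step (M := machine T k) (q := Phase.read) (d := 0) (a := some (.inl a)) (q' := Phase.read) (c' := c) rfl (by simp) hds⟩
    · obtain ⟨ds, hds⟩ := ih (c + tally [(.inr ⟨l⟩ : Letter T k)]) fun i => by
        rw [← h i, Pi.add_apply, add_assoc, ← Pi.add_apply, ← tally_append]
        rfl
      refine ⟨Pi.single l 1 :: ds, .step (M := machine T k) (q := Phase.read) (d := Pi.single l 1) (a := some (.inr ⟨l⟩)) (q' := Phase.read) rfl ?_ hds⟩
      intro i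
      by_cases hi : i = l
      · subst hi
        simp [tally]
      · have hi' : l ≠ i := Ne.symm hi
        simp [tally, hi, hi']

theorem isNCM_setOf_tally :
    IsNCM ({v | ∀ i j, tally v i = tally v j} : Language (Letter T k)) := by
  refine ⟨k, 1, machine T k, ?_, ?_⟩
  · rintro w ds q c h rfl i
    exact (of_computes_read h rfl).2 i
  · ext w
    constructor
    · rintro ⟨ds, q, c, h, rfl⟩
      exact fun i j => by simpa using (of_computes_read h rfl).1 i j
    · intro hw
      -- For `k = 0` there is no counter from which to read off the common value.
      obtain ⟨n, hn⟩ : ∃ n, ∀ i, (0 : Fin k → ℕ) i + tally w i = n := by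
        rcases isEmpty_or_nonempty (Fin k) with h | ⟨⟨i⟩⟩
        · exact ⟨0, fun i => isEmptyElim i⟩
        · exact ⟨tally w i, fun j => by simpa using hw j i⟩
      obtain ⟨ds, h⟩ := computes_read w 0 hn
      exact ⟨ds, .done, _, h, rfl⟩

end CounterLetters

/-! ### From counters to a homomorphic image -/

open CounterLetters in
theorem IsLinearIndexedWithCounters.exists_eq_homImage {T : Type u} [Finite T] {L : Language T}
    (hL : IsLinearIndexedWithCounters L) :
    ∃ (Γ : Type u) (_ : Finite Γ) (h : FreeMonoid Γ →* FreeMonoid T) (L₁ L₂ : Language Γ),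
      IsLinearIndexed L₁ ∧ IsNCM L₂ ∧ L = homImage h (L₁ ⊓ L₂) := by
  obtain ⟨k, G, hG, rfl⟩ := hL
  let h : FreeMonoid (Letter T k) →* FreeMonoid T :=
    { toFun := fun v => FreeMonoid.ofList (erase v.toList)
      map_one' := rfl
      map_mul' := fun v w => erase_append _ _ }
  refine ⟨Letter T k, inferInstance, h, (grammar G).language, _,
    isLinearIndexed_iff.2 ⟨_, grammar_isLinear hG, rfl⟩, isNCM_setOf_tally, ?_⟩
  ext u
  rw [CounterLetters.mem_language_iff]
  constructor
  · rintro ⟨v, hv, ht, hu⟩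
    exact ⟨v, ⟨hv, ht⟩, hu⟩
  · rintro ⟨v, ⟨hv, ht⟩, hu⟩
    exact ⟨v, hv, ht, hu⟩

/-! ### Automata with weights in a free commutative monoid -/

/-- A nondeterministic automaton with `λ`-transitions which are labelled; every label has a weight
in `ℕ^J`. -/
structure WeightedAutomaton (Γ : Type u) (J : Type) where
  /-- states -/
  State : Type
  /-- labels of transitions -/
  Label : Type
  finite_state : Finite State
  finite_label : Finite Label
  /-- the weight of a label -/
  weight : Label → J → ℕ
  /-- transition relation -/
  step : State → Option Γ → Label → State → Prop
  /-- initial states -/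
  start : Set State
  /-- accepting states -/
  accept : Set State

namespace WeightedAutomaton

variable {Γ : Type u} {J : Type}

/-- `M.Run q w n q'`: there is a computation from `q` to `q'` that reads `w` and whose transitions
have total weight `n`. -/
inductive Run (M : WeightedAutomaton Γ J) : M.State → List Γ → (J → ℕ) → M.State → Prop
  | refl (q : M.State) : Run M q [] 0 q
  | step {q p q' : M.State} {a : Option Γ} {l : M.Label} {w : List Γ} {n : J → ℕ}
      (h : M.step q a l p) (hr : Run M p w n q') : Run M q (a.toList ++ w) (M.weight l + n) q'

/-- The words accepted with all components of the weight equal. -/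
def balancedLanguage (M : WeightedAutomaton Γ J) : Language Γ :=
  {w | ∃ s ∈ M.start, ∃ q ∈ M.accept, ∃ n, M.Run s w n q ∧ ∀ i j, n i = n j}

namespace Run

variable {M : WeightedAutomaton Γ J} {q q' : M.State}

theorem trans {p : M.State} {v w : List Γ} {m n : J → ℕ} (h : M.Run q v m p)
    (h' : M.Run p w n q') : M.Run q (v ++ w) (m + n) q' := by
  induction h with
  | refl => simpa using h'
  | step hs _ ih =>
    rw [List.append_assoc, add_assoc]
    exact .step hs (ih h')

theorem exists_of_append {v w : List Γ} {n : J → ℕ} (h : M.Run q (v ++ w) n q') :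
    ∃ p m m', M.Run q v m p ∧ M.Run p w m' q' ∧ n = m + m' := by
  generalize hx : v ++ w = x at h
  induction h generalizing v with
  | refl q =>
    obtain ⟨rfl, rfl⟩ := List.append_eq_nil_iff.1 hx
    exact ⟨q, 0, 0, .refl q, .refl q, rfl⟩
  | @step q p q' a l x n hs hr ih =>
    cases a with
    | none =>
      obtain ⟨p', m, m', h, h', rfl⟩ := ih hx
      exact ⟨p', M.weight l + m, m', .step hs h, h', (add_assoc ..).symm⟩
    | some a =>
      cases v with
      | nil =>
        rw [List.nil_append] at hx
        exact ⟨q, 0, _, .refl q, hx ▸ .step hs hr, (zero_add _).symm⟩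
      | cons b v =>
        simp only [Option.toList_some, List.cons_append, List.nil_append, List.cons.injEq] at hx
        obtain ⟨rfl, hx⟩ := hx
        obtain ⟨p', m, m', h, h', rfl⟩ := ih hx
        exact ⟨p', M.weight l + m, m', .step hs h, h', (add_assoc ..).symm⟩

end Run

/-- The automaton with renamed components of the weights. -/
def reindex {K : Type} (M : WeightedAutomaton Γ J) (e : K ≃ J) : WeightedAutomaton Γ K where
  State := M.State
  Label := M.Label
  finite_state := M.finite_state
  finite_label := M.finite_label
  weight l i := M.weight l (e i)
  step := M.step
  start := M.start
  accept := M.accept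

theorem Run.reindex {K : Type} {M : WeightedAutomaton Γ J} (e : K ≃ J) {q q' : M.State}
    {w : List Γ} {n : J → ℕ} (h : M.Run q w n q') :
    (M.reindex e).Run q w (fun i => n (e i)) q' := by
  induction h with
  | refl q => exact .refl (M := M.reindex e) q
  | step hs _ ih => exact .step (M := M.reindex e) hs ih

theorem balancedLanguage_le_reindex {K : Type} (M : WeightedAutomaton Γ J) (e : K ≃ J) :
    M.balancedLanguage ≤ (M.reindex e).balancedLanguage := by
  rintro w ⟨s, hs, q, hq, n, h, hn⟩
  exact ⟨s, hs, q, hq, _, h.reindex e, fun i j => hn _ _⟩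

theorem balancedLanguage_reindex {K : Type} (M : WeightedAutomaton Γ J) (e : K ≃ J) :
    (M.reindex e).balancedLanguage = M.balancedLanguage := by
  refine le_antisymm ?_ (M.balancedLanguage_le_reindex e)
  have h := (M.reindex e).balancedLanguage_le_reindex e.symm
  have : (M.reindex e).reindex e.symm = M := by simp [reindex]
  rwa [this] at h

/-! ### Replacing inequalities between weights by equality of all weights -/

variable {E : Type}

/-- The words accepted with a weight whose components `(e, true)` and `(e, false)` are compared
for all `e`: they have to be equal, or the former has to be larger, depending on the last state. -/
def comparisonLanguage (M : WeightedAutomaton Γ (E × Bool)) (κ : M.State → E → Bool) :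
    Language Γ :=
  {w | ∃ s ∈ M.start, ∃ q ∈ M.accept, ∃ n, M.Run s w n q ∧
    ∀ e, if κ q e then n (e, true) = n (e, false) else n (e, false) < n (e, true)}

section Padding

variable [Finite E] [DecidableEq E] (M : WeightedAutomaton Γ (E × Bool)) (κ : M.State → E → Bool)

/-- After acceptance, the smaller components of the weight are increased by the right amounts. -/
abbrev padding : WeightedAutomaton Γ (E × Bool) where
  State := M.State ⊕ M.State
  Label := M.Label ⊕ M.State ⊕ E × Bool
  finite_state := have := M.finite_state; inferInstance
  finite_label := have := M.finite_state; have := M.finite_label; inferInstance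
  weight
    | .inl l => M.weight l
    -- The transition out of acceptance contributes one compulsory unit for each strict inequality;
    -- the loops supply the rest.
    | .inr (.inl q) => fun x => if x.2 = false ∧ κ q x.1 = false then 1 else 0
    | .inr (.inr (e, b)) => Pi.single (e, false) 1 + if b then Pi.single (e, true) 1 else 0
  step
    | .inl q, a, .inl l, .inl q' => M.step q a l q'
    | .inl q, none, .inr (.inl p), .inr q' => q ∈ M.accept ∧ p = q ∧ q' = q
    | .inr q, none, .inr (.inr (e, b)), .inr q' => q' = q ∧ (κ q e = false ∨ b = true)
    | _, _, _, _ => False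
  start := .inl '' M.start
  accept := Set.range .inr

variable {M κ}

/-- No loop favours `(e, true)`, and a loop favouring `(e, false)` exists only where a strict
inequality is claimed. -/
theorem Run.of_padding_inr {q : M.State} {x y : (M.padding κ).State} {w : List Γ}
    {n : E × Bool → ℕ} (h : (M.padding κ).Run x w n y) (hx : x = .inr q) :
    y = .inr q ∧ w = [] ∧
      ∀ e, n (e, true) ≤ n (e, false) ∧ (κ q e = true → n (e, true) = n (e, false)) := by
  induction h with
  | refl => exact ⟨hx, rfl, fun e => ⟨le_rfl, fun _ => rfl⟩⟩
  | @step x y z a l w n hs _ ih =>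
    subst hx
    rcases a with - | a <;> rcases l with l | l | ⟨e, b⟩ <;> rcases y with y | y <;>
      simp at hs
    obtain ⟨rfl, hb⟩ := hs
    obtain ⟨rfl, rfl, h⟩ := ih rfl
    refine ⟨rfl, rfl, fun e' => ?_⟩
    obtain ⟨h₁, h₂⟩ := h e'
    by_cases he : e' = e
    · subst he
      cases b
      · simp at hb ⊢
        simp [hb]
        omega
      · simp
        exact ⟨h₁, h₂⟩
    · cases b <;> simpa [he] using ⟨h₁, h₂⟩

theorem Run.of_padding_inl {q q' : M.State} {x y : (M.padding κ).State} {w : List Γ}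
    {n : E × Bool → ℕ} (h : (M.padding κ).Run x w n y) (hx : x = .inl q) (hy : y = .inr q') :
    q' ∈ M.accept ∧ ∃ m r, M.Run q w m q' ∧ n = m + r ∧
      ∀ e, if κ q' e then r (e, true) = r (e, false) else r (e, true) < r (e, false) := by
  induction h generalizing q with
  | refl => simp_all
  | @step x y z a l w n hs hr ih =>
    subst hx
    rcases a with - | a <;> rcases l with l | l | ⟨e, b⟩ <;> rcases y with y | y <;>
      simp at hs
    · obtain ⟨h₁, m, r, hm, rfl, h₂⟩ := ih rfl hy
      exact ⟨h₁, _, r, .step hs hm, (add_assoc ..).symm, h₂⟩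
    · obtain ⟨h₁, rfl, rfl⟩ := hs
      obtain ⟨h₂, rfl, h₃⟩ := hr.of_padding_inr rfl
      obtain rfl := Sum.inr_injective (hy.symm.trans h₂)
      refine ⟨h₁, 0, _, .refl _, (zero_add _).symm, fun e => ?_⟩
      obtain ⟨h₄, h₅⟩ := h₃ e
      split_ifs with h
      · simp [h, h₅ h]
      · simp [h]
        omega
    · obtain ⟨h₁, m, r, hm, rfl, h₂⟩ := ih rfl hy
      exact ⟨h₁, _, r, .step hs hm, (add_assoc ..).symm, h₂⟩

theorem Run.padding_inl {q q' : M.State} {w : List Γ} {n : E × Bool → ℕ} (h : M.Run q w n q') :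
    (M.padding κ).Run (.inl q) w n (.inl q') := by
  induction h with
  | refl q => exact .refl (M := M.padding κ) (.inl q)
  | @step q p q' a l w n hs _ ih =>
    refine .step (M := M.padding κ) (l := .inl l) (p := .inl p) ?_ ih
    cases a <;> exact hs

/-- The weights of `λ`-loops at a state form a submonoid, so it suffices to realize the generators.
-/
theorem run_padding_inr (q : M.State) (a b : E → ℕ) (h : ∀ e, κ q e = true → a e = 0) :
    ∃ r, (M.padding κ).Run (.inr q) [] r (.inr q) ∧
      ∀ e, r (e, true) = b e ∧ r (e, false) = a e + b e := by
  have := Fintype.ofFinite E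
  let R : AddSubmonoid (E × Bool → ℕ) :=
    { carrier := {r | (M.padding κ).Run (.inr q) [] r (.inr q)}
      zero_mem' := .refl (M := M.padding κ) (.inr q)
      add_mem' := fun h h' => Run.trans h h' }
  have hR (e : E) (c : Bool) (h : κ q e = false ∨ c = true) :
      (Pi.single (e, false) 1 + if c then Pi.single (e, true) 1 else 0) ∈ R := by
    have : (M.padding κ).step (.inr q) none (.inr (.inr (e, c))) (.inr q) := ⟨rfl, h⟩
    exact Run.step this (.refl (M := M.padding κ) (.inr q))
  refine ⟨∑ e, (a e • (Pi.single (e, false) 1 + 0) +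
    b e • (Pi.single (e, false) 1 + Pi.single (e, true) 1)), ?_, fun e => ?_⟩
  · change _ ∈ R
    refine sum_mem fun e _ => add_mem ?_ (nsmul_mem (by simpa using hR e true (.inr rfl)) _)
    cases he : κ q e
    · exact nsmul_mem (by simpa using hR e false (.inl he)) _
    · rw [h e he, zero_smul]
      exact zero_mem R
  · simp [Finset.sum_apply, Pi.single_apply, Finset.sum_add_distrib]

theorem balancedLanguage_padding :
    (M.padding κ).balancedLanguage = M.comparisonLanguage κ := by
  ext w
  constructor
  · rintro ⟨_, ⟨s, hs, rfl⟩, _, ⟨q, rfl⟩, n, h, hn⟩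
    obtain ⟨hq, m, r, hm, rfl, hr⟩ := h.of_padding_inl rfl rfl
    refine ⟨s, hs, q, hq, m, hm, fun e => ?_⟩
    have h₁ := hn (e, true) (e, false)
    have h₂ := hr e
    simp only [Pi.add_apply] at h₁
    split_ifs at h₂ ⊢ <;> omega
  · rintro ⟨s, hs, q, hq, n, h, hn⟩
    have := Fintype.ofFinite E
    -- Any common upper bound of the components serves as the final value.
    let C := ∑ x, n x
    have hC (x) : n x ≤ C := Finset.single_le_sum (fun _ _ => Nat.zero_le _) (Finset.mem_univ x)
    -- The first family of loops closes the gap between the two components, less the compulsory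
    -- unit; the second raises both to `C`.
    obtain ⟨r, hr, hr'⟩ := run_padding_inr (κ := κ) q
      (fun e => n (e, true) - n (e, false) - if κ q e then 0 else 1) (fun e => C - n (e, true))
      (fun e he => by have := hn e; simp_all)
    have hstep : (M.padding κ).step (.inl q) none (.inr (.inl q)) (.inr q) := ⟨hq, rfl, rfl⟩
    have hrun := (h.padding_inl (κ := κ)).trans (.step hstep hr)
    refine ⟨.inl s, ⟨s, hs, rfl⟩, .inr q, ⟨q, rfl⟩, _, by simpa using hrun, ?_⟩
    suffices ∀ x, n x + ((if x.2 = false ∧ κ q x.1 = false then 1 else 0) + r x) = C from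
      fun i j => (this i).trans (this j).symm
    rintro ⟨e, b⟩
    have h₁ := hn e
    have h₂ := hC (e, true)
    have h₃ := hC (e, false)
    obtain ⟨h₄, h₅⟩ := hr' e
    cases b <;> cases hκ : κ q e <;> simp [hκ] at h₁ h₅ ⊢ <;> omega

end Padding

end WeightedAutomaton

/-! ### Reversal-bounded counters as weights -/

namespace CounterMachine

variable {Γ : Type u} {k : ℕ}

/-- The sign condition on a counter value: it is zero, or it is positive. -/
def HasStatus (z : Bool) (x : ℤ) : Prop := if z then x = 0 else 0 < x

/-- The simulation of a counter machine by an automaton with weights. For every counter, a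
computation is divided into at most `m` segments, in each of which the counter is always zero or
always positive before the steps, and moves in one direction only (except in the last step, which
leads to another segment). The first component of a state holds guesses of the status and of the
direction in each segment, the last one the present segments. The component `(i, p, false)` of the
weight is the value of the counter `i` at the beginning of segment `p`, and `(i, p, true)` is its
value at the end; increments and decrements are counted separately. -/
abbrev segmented (M : CounterMachine Γ k) (m : ℕ) :
    WeightedAutomaton Γ ((Fin k × Fin m × Bool) × Bool) where
  State := (Fin k → Fin m → Bool × SignType) × M.State × (Fin k → Fin m)
  Label := (Fin k → SignType) × (Fin k → Fin m) × (Fin k → Fin m)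
  finite_state := have := M.finite_state; inferInstance
  finite_label := inferInstance
  weight l x :=
    if (if x.1.2.2 then l.2.2 x.1.1 ≤ x.1.2.1 else l.2.1 x.1.1 < x.1.2.1) ∧
      l.1 x.1.1 = (if x.2 then 1 else -1) then 1 else 0
  step σ a l τ :=
    τ.1 = σ.1 ∧ l.2.1 = σ.2.2 ∧ l.2.2 = τ.2.2 ∧
      (τ.2.1, l.1) ∈ M.step σ.2.1 a (fun i => (σ.1 i (σ.2.2 i)).1) ∧
      ∀ i, (τ.2.2 i = σ.2.2 i ∧ (l.1 i = 0 ∨ l.1 i = (σ.1 i (σ.2.2 i)).2)) ∨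
        σ.2.2 i < τ.2.2 i
  start := {σ | σ.2.1 = M.start ∧ ∀ i, (σ.2.2 i : ℕ) = 0 ∧ (σ.1 i (σ.2.2 i)).1 = true}
  accept := {σ | σ.2.1 ∈ M.accept}

/-- The difference of the two components of a weight that belong to `e`. -/
def net {E : Type} (n : E × Bool → ℕ) (e : E) : ℤ := n (e, true) - n (e, false)

theorem net_add {E : Type} (n n' : E × Bool → ℕ) (e : E) : net (n + n') e = net n e + net n' e := by
  simp only [net, Pi.add_apply]
  push_cast
  ring

variable {M : CounterMachine Γ k} {m : ℕ}

theorem net_weight (l : (M.segmented m).Label) (i : Fin k) (p : Fin m) (b : Bool) :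
    net ((M.segmented m).weight l) (i, p, b) =
      if (if b then l.2.2 i ≤ p else l.2.1 i < p) then (l.1 i : ℤ) else 0 := by
  simp only [net]
  by_cases h : if b then l.2.2 i ≤ p else l.2.1 i < p
  · simp only [h, true_and, if_true]
    rcases h' : l.1 i <;> simp
  · simp [h]

/-- Segments are never revisited, so the values at the ends of past segments, and at the beginning
of the present one, receive no further contributions. Steps inside the present segment follow its
guessed direction, so its end value can change in that direction only. -/
theorem eq_zero_of_run_segmented {σ τ : (M.segmented m).State} {w : List Γ}
    {n : (Fin k × Fin m × Bool) × Bool → ℕ} (h : (M.segmented m).Run σ w n τ) (i : Fin k)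
    (p : Fin m) (b : Bool) :
    (p ≤ σ.2.2 i → n ((i, p, false), b) = 0) ∧ (p < σ.2.2 i → n ((i, p, true), b) = 0) ∧
      (p ≤ σ.2.2 i → (σ.1 i p).2 ≠ (if b then 1 else -1) → n ((i, p, true), b) = 0) := by
  induction h with
  | refl => simp
  | @step σ ρ τ a l w n hs _ ih =>
    obtain ⟨hγ, hj, hj', -, hd⟩ := hs
    rw [hγ] at ih
    have hle : σ.2.2 i ≤ ρ.2.2 i := by
      rcases hd i with h | h
      · exact h.1.ge
      · exact h.le
    obtain ⟨h₁, h₂, h₃⟩ := ih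
    simp only [Pi.add_apply, hj, hj']
    refine ⟨fun h => ?_, fun h => ?_, fun h hb => ?_⟩
    · rw [h₁ (h.trans hle), if_neg (by simp [h])]
    · rw [h₂ (h.trans_le hle), if_neg (by simp [h.trans_le hle])]
    · rw [h₃ (h.trans hle) hb, if_neg]
      rintro ⟨hp, hdb⟩
      simp only [if_true] at hp
      rcases hd i with ⟨he, hd⟩ | hd
      · obtain rfl : p = σ.2.2 i := le_antisymm h (he ▸ hp)
        rcases hd with hd | hd
        · rw [hd] at hdb
          cases b <;> simp at hdb
        · exact hb (hd.symm.trans hdb)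
      · exact absurd (hd.trans_le hp) h.not_gt

/-- Since `n` collects only the remaining steps, the values at the ends of segments are `c i` plus a
net weight. The induction verifies that the guessed status is the true one before every step, so the
zero tests of `M` have the guessed outcome. -/
theorem computes_of_run_segmented {σ τ : (M.segmented m).State} {w : List Γ}
    {n : (Fin k × Fin m × Bool) × Bool → ℕ} (h : (M.segmented m).Run σ w n τ) (c : Fin k → ℕ)
    (hc : ∀ i, HasStatus (σ.1 i (σ.2.2 i)).1 (c i))
    (hstart : ∀ i p, σ.2.2 i < p → HasStatus (σ.1 i p).1 (c i + net n (i, p, false)))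
    (hend : ∀ i p, σ.2.2 i ≤ p → HasStatus (σ.1 i p).1 (c i + net n (i, p, true))) :
    ∃ ds c', M.Computes σ.2.1 c w ds τ.2.1 c' := by
  induction h generalizing c with
  | refl => exact ⟨[], c, .refl _ _⟩
  | @step σ ρ τ a l w n hs hr ih =>
    obtain ⟨hγ, hj, hj', ht, hd⟩ := hs
    rw [hγ] at ih
    have hle (i) : σ.2.2 i ≤ ρ.2.2 i := by
      rcases hd i with h | h
      · exact h.1.ge
      · exact h.le
    have hstart' (i p) (hp : σ.2.2 i < p) :
        HasStatus (σ.1 i p).1 (c i + l.1 i + net n (i, p, false)) := by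
      have := hstart i p hp
      rw [net_add, net_weight, ← add_assoc] at this
      simpa only [hj, hp, Bool.false_eq_true, if_false, if_true] using this
    have hend' (i p) (hp : ρ.2.2 i ≤ p) :
        HasStatus (σ.1 i p).1 (c i + l.1 i + net n (i, p, true)) := by
      have := hend i p ((hle i).trans hp)
      rw [net_add, net_weight, ← add_assoc] at this
      simpa only [hj', hp, if_true] using this
    -- Inside a segment the new value lies between the present value and the value at the end, which
    -- share the guessed status. On entering a segment it is the value at its beginning.
    have hnew (i) : HasStatus (σ.1 i (ρ.2.2 i)).1 (c i + l.1 i) := by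
      rcases hd i with ⟨he, hd⟩ | hd
      · have h₁ := hc i
        have h₂ := hend' i (ρ.2.2 i) le_rfl
        have h₃ := fun b => (eq_zero_of_run_segmented hr i (ρ.2.2 i) b).2.2 le_rfl
        rw [hγ] at h₃
        rw [he] at h₂ h₃ ⊢
        have h₄ := h₃ true
        have h₅ := h₃ false
        simp only [net] at h₂
        rcases hs : (σ.1 i (σ.2.2 i)).2 <;> rcases hz : (σ.1 i (σ.2.2 i)).1 <;>
          rw [hs] at hd h₄ h₅ <;> rcases hdi : l.1 i <;>
          simp [hz, hdi, HasStatus] at h₁ h₂ h₄ h₅ hd ⊢ <;> omega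
      · have h₁ := hstart' i _ hd
        have h₂ := fun b => (eq_zero_of_run_segmented hr i (ρ.2.2 i) b).1 le_rfl
        simp only [net, h₂] at h₁
        simpa using h₁
    have hnonneg (i) : 0 ≤ (c i : ℤ) + l.1 i := by
      have := hnew i
      rw [HasStatus] at this
      split_ifs at this <;> omega
    obtain ⟨ds, c', h⟩ := ih (fun i => ((c i : ℤ) + l.1 i).toNat)
      (fun i => by rw [Int.toNat_of_nonneg (hnonneg i)]; exact hnew i)
      (fun i p hp => by
        rw [Int.toNat_of_nonneg (hnonneg i)]
        exact hstart' i p ((hle i).trans_lt hp))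
      (fun i p hp => by
        rw [Int.toNat_of_nonneg (hnonneg i)]
        exact hend' i p hp)
    refine ⟨l.1 :: ds, c', .step ?_ (fun i => Int.toNat_of_nonneg (hnonneg i)) h⟩
    convert ht using 2
    funext i
    have := hc i
    rw [HasStatus] at this
    split_ifs at this with hz
    · simpa [hz] using this
    · simp [hz]
      omega

/-- A bound for the number of times that a counter of the given status and direction leaves a
segment without a reversal. -/
def pending (x : Bool × SignType) : ℕ := if x = (true, 1) ∨ x = (false, -1) then 1 else 0

theorem hasStatus_decide (c : ℕ) : HasStatus (decide (c = 0)) c := by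
  by_cases h : c = 0 <;> simp [HasStatus, h]
  omega

/-- The left side of `hb` is a potential that does not grow. Without a reversal the status changes
only when a rising counter leaves zero or a falling one reaches zero, which uses up `pending`. A
reversal frees two units: one for the new segment and one for its `pending`. -/
theorem exists_next_segment {l : ℕ} (c c' : ℕ) (d : SignType) (ds : List SignType)
    (h : (c' : ℤ) = c + d) (x : Bool × SignType) (j : Fin (2 * l + 2))
    (hx : x.1 = decide (c = 0)) (hx' : x.2 ≠ 0)
    (hb : j + 2 * reversalsFrom x.2 (d :: ds) + pending x ≤ 2 * l + 1) :
    ∃ (j' : Fin (2 * l + 2)) (x' : Bool × SignType), x'.1 = decide (c' = 0) ∧ x'.2 ≠ 0 ∧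
      j' + 2 * reversalsFrom x'.2 ds + pending x' ≤ 2 * l + 1 ∧
      ((j' = j ∧ x' = x ∧ (d = 0 ∨ d = x.2)) ∨ (j' : ℕ) = j + 1) := by
  obtain ⟨z, s⟩ := x
  simp only at hx hx' hb
  have hlt (h : (j : ℕ) < 2 * l + 1) :
      ∃ j' : Fin (2 * l + 2), (j' : ℕ) = j + 1 := ⟨⟨j + 1, by omega⟩, rfl⟩
  rw [reversalsFrom] at hb
  by_cases hd : d = 0 ∨ d = s
  · rw [if_pos hd] at hb
    by_cases hz : z = decide (c' = 0)
    · exact ⟨j, (z, s), hz, hx', hb, .inl ⟨rfl, rfl, hd⟩⟩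
    · have hp : pending (z, s) = 1 ∧ pending (decide (c' = 0), s) = 0 := by
        rcases hd with rfl | rfl
        · simp at h
          simp [hx, h] at hz
        · by_cases h₁ : c = 0 <;> by_cases h₂ : c' = 0 <;> cases d <;>
            (simp_all [pending]; try omega)
      obtain ⟨j', hj'⟩ := hlt (by omega)
      exact ⟨j', (decide (c' = 0), s), rfl, hx', by simp only [hj', hp] at hb ⊢; omega, .inr hj'⟩
  · rw [if_neg hd] at hb
    push Not at hd
    obtain ⟨j', hj'⟩ := hlt (by omega)
    refine ⟨j', (decide (c' = 0), d), rfl, hd.1, ?_, .inr hj'⟩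
    have : pending (decide (c' = 0), d) ≤ 1 := by rw [pending]; split_ifs <;> simp
    simp only [hj']
    omega

/-- The guesses are fixed along a run but depend on its future. Hence `γ₀` holds those already made,
up to the present segments, and the induction yields a `γ` extending them. -/
theorem Computes.exists_run_segmented {l : ℕ} {q q' : M.State} {c c' : Fin k → ℕ} {w : List Γ}
    {ds : List (Fin k → SignType)} (h : M.Computes q c w ds q' c')
    (γ₀ : Fin k → Fin (2 * l + 2) → Bool × SignType) (j : Fin k → Fin (2 * l + 2))
    (hz : ∀ i, (γ₀ i (j i)).1 = decide (c i = 0)) (hs : ∀ i, (γ₀ i (j i)).2 ≠ 0)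
    (hb : ∀ i, j i + 2 * reversalsFrom (γ₀ i (j i)).2 (ds.map fun d => d i) +
      pending (γ₀ i (j i)) ≤ 2 * l + 1) :
    ∃ γ j' n, (∀ i p, p ≤ j i → γ i p = γ₀ i p) ∧
      (M.segmented (2 * l + 2)).Run (γ, q, j) w n (γ, q', j') ∧
      (∀ i p, j i < p → HasStatus (γ i p).1 (c i + net n (i, p, false))) ∧
      ∀ i p, j i ≤ p → HasStatus (γ i p).1 (c i + net n (i, p, true)) := by
  induction h generalizing γ₀ j with
  | refl q c =>
    -- Segments never entered begin and end with the final value, so they receive its status; their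
    -- direction is arbitrary.
    refine ⟨fun i p => if p ≤ j i then γ₀ i p else (decide (c i = 0), 1), j, 0,
      fun i p hp => if_pos hp, .refl _, fun i p hp => ?_, fun i p hp => ?_⟩
    · simpa [hp.not_ge, net] using hasStatus_decide (c i)
    · rcases hp.eq_or_lt with rfl | hp
      · simpa [net, hz i] using hasStatus_decide (c i)
      · simpa [hp.not_ge, net] using hasStatus_decide (c i)
  | @step q q₁ q' c c₁ c' a w d ds ht hu _ ih =>
    choose j₁ x hx hx' hxb hj₁ using fun i =>
      exists_next_segment (c i) (c₁ i) (d i) (ds.map fun d : Fin k → SignType => d i) (hu i) (γ₀ i (j i)) (j i) (hz i)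
        (hs i) (hb i)
    obtain ⟨γ, j', n, hγ, hr, hstart, hend⟩ := ih
      (fun i p => if p = j₁ i then x i else γ₀ i p) j₁ (by simpa using hx) (by simpa using hx')
      (by simpa using hxb)
    have hle (i) : j i ≤ j₁ i := by
      rcases hj₁ i with h | h
      · exact h.1.ge
      · exact Fin.le_def.2 (by omega)
    have hγ' (i p) (hp : p ≤ j i) : γ i p = γ₀ i p := by
      rw [hγ i p (hp.trans (hle i))]
      split_ifs with h
      · rcases hj₁ i with ⟨h₁, h₂, -⟩ | h₁
        · rw [h₂, h, h₁]
        · rw [h, Fin.le_def] at hp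
          omega
      · rfl
    have hstatus (i) : HasStatus (γ i (j₁ i)).1 (c₁ i) := by
      rw [hγ i _ le_rfl, if_pos rfl, hx]
      exact hasStatus_decide _
    have hstep : (M.segmented (2 * l + 2)).step (γ, q, j) a (d, j, j₁) (γ, q₁, j₁) := by
      refine ⟨rfl, rfl, rfl, ?_, fun i => ?_⟩
      · convert ht using 2
        funext i
        simp only [hγ' i _ le_rfl, hz]
      · simp only [hγ' i _ le_rfl]
        rcases hj₁ i with ⟨h₁, -, h₂⟩ | h₁
        · exact .inl ⟨h₁, h₂⟩
        · exact .inr (Fin.lt_def.2 (by omega))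
    refine ⟨γ, j', _, hγ', .step hstep hr, fun i p hp => ?_, fun i p hp => ?_⟩
    · rw [net_add, net_weight, ← add_assoc]
      simp only [hp, Bool.false_eq_true, if_false, if_true]
      rw [← hu i]
      by_cases hp' : j₁ i < p
      · exact hstart i p hp'
      · obtain rfl : p = j₁ i := by
          rcases hj₁ i with ⟨h₁, -⟩ | h₁
          · exact absurd (h₁ ▸ hp) hp'
          · rw [Fin.lt_def] at hp hp'
            exact Fin.ext (by omega)
        have h₂ := fun b => (eq_zero_of_run_segmented hr i (j₁ i) b).1 le_rfl
        simpa [net, h₂] using hstatus i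
    · rw [net_add, net_weight, ← add_assoc]
      by_cases hp' : j₁ i ≤ p
      · simp only [hp', if_true]
        rw [← hu i]
        exact hend i p hp'
      · obtain rfl : p = j i := by
          rcases hj₁ i with ⟨h₁, -⟩ | h₁
          · exact absurd (h₁ ▸ hp) hp'
          · rw [Fin.le_def] at hp hp'
            exact Fin.ext (by omega)
        have h₂ := fun b => (eq_zero_of_run_segmented hr i (j i) b).2.1 (not_le.1 hp')
        simp only [hp', if_true, if_false, add_zero, net, h₂, hγ' i _ le_rfl, hz]
        simpa using hasStatus_decide (c i)

theorem comparisonLanguage_segmented {l : ℕ} (hM : M.IsReversalBounded l) :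
    (M.segmented (2 * l + 2)).comparisonLanguage (fun σ e => (σ.1 e.1 e.2.1).1) = M.language := by
  have key (z : Bool) (n : (Fin k × Fin (2 * l + 2) × Bool) × Bool → ℕ) (e) :
      (if z then n (e, true) = n (e, false) else n (e, false) < n (e, true)) ↔
        HasStatus z (net n e) := by
    rw [HasStatus, net]
    split_ifs <;> omega
  -- The guesses in the last state, which determine the comparisons, are those of the initial state.
  have hconst {σ τ : (M.segmented (2 * l + 2)).State} {w n}
      (h : (M.segmented (2 * l + 2)).Run σ w n τ) : τ.1 = σ.1 := by
    induction h with
    | refl => rfl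
    | step h _ ih => exact ih.trans h.1
  ext w
  constructor
  · rintro ⟨σ, ⟨hq, hj⟩, τ, hτ, n, h, hn⟩
    simp only [key, hconst h] at hn
    obtain ⟨ds, c', hc⟩ := computes_of_run_segmented h 0 (fun i => by simp [(hj i).2, HasStatus])
      (fun i p _ => by simpa using hn (i, p, false)) (fun i p _ => by simpa using hn (i, p, true))
    exact ⟨ds, τ.2.1, c', hq ▸ hc, hτ⟩
  · rintro ⟨ds, q, c, h, hq⟩
    obtain ⟨γ, j', n, hγ, hr, hstart, hend⟩ := h.exists_run_segmented (l := l)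
      (fun _ _ => (true, 1)) (fun _ => 0) (by simp) (by simp)
      -- A counter at zero that is about to rise has `pending` equal to 1, so the potential starts
      -- at no more than `2 * l + 1`.
      (fun i => by
        have := hM w ds q c h hq i
        simp [pending]
        omega)
    refine ⟨_, ⟨rfl, fun i => ⟨rfl, congrArg Prod.fst (hγ i 0 le_rfl)⟩⟩, _, hq, n, hr, fun ⟨i, p, b⟩ => ?_⟩
    rw [key]
    cases b with
    | true => simpa using hend i p (Fin.zero_le _)
    | false =>
      rcases (Fin.zero_le p).eq_or_lt with rfl | hp
      · have h₂ := fun b => (eq_zero_of_run_segmented hr i 0 b).1 le_rfl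
        simp [net, h₂, hγ, HasStatus]
      · simpa using hstart i p hp

end CounterMachine

theorem IsNCM.exists_weightedAutomaton {Γ : Type u} {L : Language Γ} (hL : IsNCM L) :
    ∃ (K : ℕ) (M : WeightedAutomaton Γ (Fin K)), M.balancedLanguage = L := by
  obtain ⟨k, l, M, hM, rfl⟩ := hL
  refine ⟨_, ((M.segmented (2 * l + 2)).padding fun σ e => (σ.1 e.1 e.2.1).1).reindex
    (Finite.equivFin _).symm, ?_⟩
  rw [WeightedAutomaton.balancedLanguage_reindex, WeightedAutomaton.balancedLanguage_padding,
    CounterMachine.comparisonLanguage_segmented hM]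

/-! ### Intersection with the language of an automaton -/

theorem Symbol.finite {T : Type u} {N : Type} [Finite T] [Finite N] : Finite (Symbol T N) :=
  Finite.of_surjective (Sum.elim .terminal .nonterminal : T ⊕ N → Symbol T N) fun x => by
    cases x with
    | terminal a => exact ⟨.inl a, rfl⟩
    | nonterminal A => exact ⟨.inr A, rfl⟩

/-- The length of the word on the right-hand side of a production. -/
def IndexedRule.rhsLength {T : Type u} {N I : Type} : IndexedRule T N I → ℕ
  | .rewrite _ ν => ν.length
  | .push _ _ _ => 0
  | .pop _ _ ν => ν.length

theorem IndexedRule.finite_rhsLength_le {T : Type u} {N I : Type} [Finite T] [Finite N] [Finite I]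
    (b : ℕ) : {r : IndexedRule T N I | r.rhsLength ≤ b}.Finite := by
  have := Symbol.finite (T := T) (N := N)
  have : Finite {ν : List (Symbol T N) // ν.length ≤ b} := List.finite_length_le _ b
  refine (Set.finite_range fun x : (N × {ν : List (Symbol T N) // ν.length ≤ b}) ⊕ (N × N × I) ⊕
    (N × I × {ν : List (Symbol T N) // ν.length ≤ b}) => match x with
      | .inl (A, ν) => IndexedRule.rewrite A ν.1
      | .inr (.inl (A, B, f)) => .push A B f
      | .inr (.inr (A, f, ν)) => .pop A f ν.1).subset fun r hr => ?_
  cases r with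
  | rewrite A ν => exact ⟨.inl (A, ⟨ν, hr⟩), rfl⟩
  | push A B f => exact ⟨.inr (.inl (A, B, f)), rfl⟩
  | pop A f ν => exact ⟨.inr (.inr (A, f, ⟨ν, hr⟩)), rfl⟩

namespace AutomatonProduct

variable {Γ T : Type u} {K m c : ℕ} {G : CounterIndexedGrammar Γ 0}
  {M : WeightedAutomaton Γ (Fin K)}

/-- The image of a word under a homomorphism of free monoids. -/
def image (h : FreeMonoid Γ →* FreeMonoid T) (v : List Γ) : List T :=
  (h (FreeMonoid.ofList v)).toList

theorem image_append (h : FreeMonoid Γ →* FreeMonoid T) (v w : List Γ) :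
    image h (v ++ w) = image h v ++ image h w := by
  rw [image, FreeMonoid.ofList_append, map_mul, FreeMonoid.toList_mul]
  rfl

theorem image_nil (h : FreeMonoid Γ →* FreeMonoid T) : image h [] = [] := by
  rw [image, FreeMonoid.ofList_nil, map_one, FreeMonoid.toList_one]

/-- Nonterminals of the product: a new start symbol, and triples `(ν, q, q')` from which the images
of those words are derived that derive from `ν` and lead from `q` to `q'`. -/
abbrev NT (G : CounterIndexedGrammar Γ 0) (M : WeightedAutomaton Γ (Fin K)) (m : ℕ) : Type u :=
  Option ({ν : List (Symbol Γ G.NT) // ν.length ≤ m} × M.State × M.State)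

-- The triples live in the universe of `Γ`, while nonterminals must form a `Type`; `e` renames them.
variable (h : FreeMonoid Γ →* FreeMonoid T) (e : NT G M m ≃ Fin c)

/-- The productions of the product. -/
inductive IsRule : IndexedRule T (Fin c) G.Index × (Fin K → ℕ) → Prop
  | start {q q' : M.State} (hq : q ∈ M.start) (hq' : q' ∈ M.accept)
      (hm : [Symbol.nonterminal G.initial].length ≤ m) :
      IsRule (.rewrite (e none) [.nonterminal (e (some (⟨_, hm⟩, q, q')))], 0)
  | left {ν : List (Symbol Γ G.NT)} {a : Option Γ} {q p q' : M.State} {l : M.Label}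
      (hν : (a.toList.map Symbol.terminal ++ ν).length ≤ m) (hν' : ν.length ≤ m) (hs : M.step q a l p) :
      IsRule (.rewrite (e (some (⟨_, hν⟩, q, q')))
        ((image h a.toList).map .terminal ++ [.nonterminal (e (some (⟨ν, hν'⟩, p, q')))]),
        M.weight l)
  | right {ν : List (Symbol Γ G.NT)} {a : Option Γ} {q p q' : M.State} {l : M.Label}
      (hν : (ν ++ a.toList.map Symbol.terminal).length ≤ m) (hν' : ν.length ≤ m) (hs : M.step p a l q') :
      IsRule (.rewrite (e (some (⟨_, hν⟩, q, q')))
        (.nonterminal (e (some (⟨ν, hν'⟩, q, p))) :: (image h a.toList).map .terminal),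
        M.weight l)
  | finish (q : M.State) (hm : ([] : List (Symbol Γ G.NT)).length ≤ m) :
      IsRule (.rewrite (e (some (⟨[], hm⟩, q, q))) [], 0)
  | rewrite {A : G.NT} {ν : List (Symbol Γ G.NT)} {n : Fin 0 → ℕ} (q q' : M.State)
      (hr : (.rewrite A ν, n) ∈ G.rules) (hm : [Symbol.nonterminal A].length ≤ m)
      (hν : ν.length ≤ m) :
      IsRule (.rewrite (e (some (⟨_, hm⟩, q, q'))) [.nonterminal (e (some (⟨ν, hν⟩, q, q')))], 0)
  | push {A B : G.NT} {f : G.Index} {n : Fin 0 → ℕ} (q q' : M.State)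
      (hr : (.push A B f, n) ∈ G.rules) (hA : [Symbol.nonterminal A].length ≤ m)
      (hB : [Symbol.nonterminal B].length ≤ m) :
      IsRule (.push (e (some (⟨_, hA⟩, q, q'))) (e (some (⟨_, hB⟩, q, q'))) f, 0)
  | pop {A : G.NT} {f : G.Index} {ν : List (Symbol Γ G.NT)} {n : Fin 0 → ℕ} (q q' : M.State)
      (hr : (.pop A f ν, n) ∈ G.rules) (hm : [Symbol.nonterminal A].length ≤ m)
      (hν : ν.length ≤ m) :
      IsRule (.pop (e (some (⟨_, hm⟩, q, q'))) f [.nonterminal (e (some (⟨ν, hν⟩, q, q')))], 0)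

theorem finite_setOf_isRule [Finite Γ] [Finite T] : {r | IsRule h e r}.Finite := by
  have := G.finite_index
  have := M.finite_label
  obtain ⟨b, hb⟩ : ∃ b, ∀ a : Option Γ, (image h a.toList).length ≤ b := by
    obtain ⟨b, hb⟩ := (Set.finite_range fun a : Option Γ => (image h a.toList).length).bddAbove
    exact ⟨b, fun a => hb ⟨a, rfl⟩⟩
  refine ((IndexedRule.finite_rhsLength_le (T := T) (N := Fin c) (I := G.Index) (b + 1)).prod
    ((Set.finite_range M.weight).insert 0)).subset ?_
  intro r hr
  cases hr with
  | @left _ a => exact ⟨by simpa [IndexedRule.rhsLength] using hb a, .inr ⟨_, rfl⟩⟩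
  | @right _ a => exact ⟨by simpa [IndexedRule.rhsLength] using hb a, .inr ⟨_, rfl⟩⟩
  | _ => exact ⟨by simp [IndexedRule.rhsLength], .inl rfl⟩

/-- The grammar generating the image of the intersection of the language of `G` and the language
of `M`. -/
abbrev grammar [Finite Γ] [Finite T] : CounterIndexedGrammar T K where
  NT := Fin c
  Index := G.Index
  finite_nt := inferInstance
  finite_index := G.finite_index
  rules := {r | IsRule h e r}
  finite_rules := finite_setOf_isRule h e
  initial := e none

variable [Finite Γ] [Finite T]

theorem grammar_isLinear : (grammar h e).IsLinear := by
  rintro _ ⟨r, hr, rfl⟩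
  cases hr with
  | left => exact (countNonterminals_terminals_append _ _).trans_le le_rfl
  | right =>
    exact ((countNonterminals_nonterminal_cons _ _).trans
      (congrArg (· + 1) (countNonterminals_terminals _))).trans_le le_rfl
  | finish => exact Nat.zero_le _
  | push => trivial
  | _ => exact le_rfl

variable {h e}

/-! ### Every derivation of the product comes from a derivation of `G` and a run of `M` -/

theorem exists_of_generates {s : SententialForm T (grammar h e).NT (grammar h e).Index}
    {u : List T} {n : Fin K → ℕ} (H : (grammar h e).Generates s u n) (x y : List T)
    {ν : List (Symbol Γ G.NT)} (hν : ν.length ≤ m) (q q' : M.State) (α : List G.Index)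
    (hs : s = x.map .terminal ++ .nonterminal (e (some (⟨ν, hν⟩, q, q')), α) ::
      y.map .terminal) :
    ∃ v, u = x ++ image h v ++ y ∧ G.Generates (attachIndices α ν) v 0 ∧ M.Run q v n q' := by
  induction H generalizing x y ν q q' α with
  | nil => simp at hs
  | @terminal a s u n _ ih =>
    cases x with
    | nil => simp at hs
    | cons b x =>
      simp only [List.map_cons, List.cons_append, List.cons.injEq, Symbol.terminal.injEq] at hs
      obtain ⟨rfl, hs⟩ := hs
      obtain ⟨v, rfl, hv⟩ := ih x y hν q q' α hs
      exact ⟨v, rfl, hv⟩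
  | @nonterminal r hr A β w s u n hw hd ih =>
    cases x with
    | cons b x => simp at hs
    | nil =>
      simp only [List.map_nil, List.nil_append, List.cons.injEq, Symbol.nonterminal.injEq,
        Prod.mk.injEq] at hs
      obtain ⟨⟨hA, rfl⟩, rfl⟩ := hs
      cases hr with
      | start => cases hw; simp at hA
      | @left ν' a q₁ p q₂ l hν₁ hν₂ hs =>
        cases hw
        simp only [EmbeddingLike.apply_eq_iff_eq, Option.some.injEq, Prod.mk.injEq,
          Subtype.mk.injEq] at hA
        obtain ⟨rfl, rfl, rfl⟩ := hA
        obtain ⟨v, rfl, hv, hr⟩ := ih (image h a.toList) y hν₂ p q₂ β (by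
          rw [attachIndices_append, attachIndices_terminals, List.append_assoc]
          rfl)
        refine ⟨a.toList ++ v, by simp [image_append], ?_, .step hs hr⟩
        rw [attachIndices_append, attachIndices_terminals]
        simpa using (CounterIndexedGrammar.Generates.of_terminals (G := G) a.toList).append hv
      | @right ν' a q₁ p q₂ l hν₁ hν₂ hs =>
        cases hw
        simp only [EmbeddingLike.apply_eq_iff_eq, Option.some.injEq, Prod.mk.injEq,
          Subtype.mk.injEq] at hA
        obtain ⟨rfl, rfl, rfl⟩ := hA
        obtain ⟨v, rfl, hv, hr⟩ := ih [] (image h a.toList ++ y) hν₂ q₁ p β (by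
          rw [List.map_append, ← attachIndices_terminals β (image h a.toList)]
          rfl)
        refine ⟨v ++ a.toList, by simp [image_append], ?_, ?_⟩
        · rw [attachIndices_append, attachIndices_terminals]
          simpa using hv.append (.of_terminals (G := G) a.toList)
        · have := hr.trans (.step hs (.refl q₂))
          rwa [List.append_nil, add_zero, add_comm] at this
      | finish =>
        cases hw
        simp only [EmbeddingLike.apply_eq_iff_eq, Option.some.injEq, Prod.mk.injEq,
          Subtype.mk.injEq] at hA
        obtain ⟨rfl, rfl, rfl⟩ := hA
        obtain ⟨rfl, rfl⟩ := CounterIndexedGrammar.Generates.eq_of_terminals hd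
        exact ⟨[], by simp [image_nil], .nil, by simpa using .refl _⟩
      | rewrite q₁ q₂ hr hm hν' =>
        cases hw
        simp only [EmbeddingLike.apply_eq_iff_eq, Option.some.injEq, Prod.mk.injEq,
          Subtype.mk.injEq] at hA
        obtain ⟨rfl, rfl, rfl⟩ := hA
        obtain ⟨v, rfl, hv, hrun⟩ := ih [] y hν' q₁ q₂ β rfl
        refine ⟨v, rfl, ?_, by simpa using hrun⟩
        exact .of_expands hr (.rewrite _ _ _) (by simpa using hv)
      | push q₁ q₂ hr hA' hB =>
        cases hw
        simp only [EmbeddingLike.apply_eq_iff_eq, Option.some.injEq, Prod.mk.injEq,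
          Subtype.mk.injEq] at hA
        obtain ⟨rfl, rfl, rfl⟩ := hA
        obtain ⟨v, rfl, hv, hrun⟩ := ih [] y hB q₁ q₂ _ rfl
        refine ⟨v, rfl, ?_, by simpa using hrun⟩
        exact .of_expands hr (.push _ _ _ _) hv
      | pop q₁ q₂ hr hm hν' =>
        cases hw
        simp only [EmbeddingLike.apply_eq_iff_eq, Option.some.injEq, Prod.mk.injEq,
          Subtype.mk.injEq] at hA
        obtain ⟨rfl, rfl, rfl⟩ := hA
        obtain ⟨v, rfl, hv, hrun⟩ := ih [] y hν' q₁ q₂ _ rfl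
        refine ⟨v, rfl, ?_, by simpa using hrun⟩
        exact .of_expands hr (.pop _ _ _ _) (by simpa using hv)

/-! ### Every derivation of `G` with a run of `M` is simulated by the product -/

theorem generates_left {a : Option Γ} {ν : List (Symbol Γ G.NT)} {q p q' : M.State}
    {l : M.Label} {α : List G.Index} {u : List T} {n : Fin K → ℕ}
    (hν : (a.toList.map Symbol.terminal ++ ν).length ≤ m) (hν' : ν.length ≤ m)
    (hs : M.step q a l p)
    (H : (grammar h e).Generates [.nonterminal (e (some (⟨ν, hν'⟩, p, q')), α)] u n) :
    (grammar h e).Generates [.nonterminal (e (some (⟨_, hν⟩, q, q')), α)]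
      (image h a.toList ++ u) (M.weight l + n) := by
  refine .nonterminal (G := grammar h e) (IsRule.left hν hν' hs) (.rewrite _ _ _) ?_
  rw [attachIndices_append, attachIndices_terminals, List.append_nil]
  have := (CounterIndexedGrammar.Generates.of_terminals (G := grammar h e)
    (image h a.toList)).append H
  rwa [zero_add] at this

theorem generates_right {a : Option Γ} {ν : List (Symbol Γ G.NT)} {q p q' : M.State}
    {l : M.Label} {α : List G.Index} {u : List T} {n : Fin K → ℕ}
    (hν : (ν ++ a.toList.map Symbol.terminal).length ≤ m) (hν' : ν.length ≤ m)
    (hs : M.step p a l q')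
    (H : (grammar h e).Generates [.nonterminal (e (some (⟨ν, hν'⟩, q, p)), α)] u n) :
    (grammar h e).Generates [.nonterminal (e (some (⟨_, hν⟩, q, q')), α)]
      (u ++ image h a.toList) (M.weight l + n) := by
  refine .nonterminal (G := grammar h e) (IsRule.right hν hν' hs) (.rewrite _ _ _) ?_
  have := H.append (CounterIndexedGrammar.Generates.of_terminals (G := grammar h e)
    (image h a.toList))
  rw [← attachIndices_terminals α (image h a.toList), add_zero] at this
  rwa [List.append_nil]

/-- Reading a word with `λ`-transitions before and between its letters from the left. -/
theorem generates_of_run_left {w v : List Γ} {ν : List (Symbol Γ G.NT)} {q q' : M.State}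
    {α : List G.Index} {n : Fin K → ℕ} (hr : M.Run q (w ++ v) n q')
    (hν : (w.map Symbol.terminal ++ ν).length ≤ m) (hν' : ν.length ≤ m)
    (H : ∀ p n, M.Run p v n q' →
      (grammar h e).Generates [.nonterminal (e (some (⟨ν, hν'⟩, p, q')), α)] (image h v) n) :
    (grammar h e).Generates [.nonterminal (e (some (⟨_, hν⟩, q, q')), α)]
      (image h (w ++ v)) n := by
  generalize hx : w ++ v = x at hr
  induction hr generalizing w with
  | refl q =>
    obtain ⟨rfl, rfl⟩ := List.append_eq_nil_iff.1 hx
    exact H q 0 (.refl q)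
  | @step q p q' a l x n hs hr ih =>
    cases a with
    | none =>
      have := generates_left (a := none) hν hν hs (ih hν H hx)
      simpa [image_nil] using this
    | some a =>
      cases w with
      | nil =>
        rw [List.nil_append] at hx
        exact hx ▸ H q _ (hx ▸ .step hs hr)
      | cons b w =>
        simp only [Option.toList_some, List.cons_append, List.nil_append, List.cons.injEq] at hx
        obtain ⟨rfl, hx⟩ := hx
        rw [image_append]
        exact generates_left (a := some b) hν (by simp at hν ⊢; omega) hs (ih (by simp at hν ⊢; omega) H hx)

/-- Reading a word with `λ`-transitions from the right. -/
theorem generates_of_run_right {y : List Γ} {ν : List (Symbol Γ G.NT)} {q p q' : M.State}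
    {α : List G.Index} {u : List T} {n n' : Fin K → ℕ} (hr : M.Run p y n' q')
    (hν : (ν ++ y.map Symbol.terminal).length ≤ m) (hν' : ν.length ≤ m)
    (H : (grammar h e).Generates [.nonterminal (e (some (⟨ν, hν'⟩, q, p)), α)] u n) :
    (grammar h e).Generates [.nonterminal (e (some (⟨_, hν⟩, q, q')), α)]
      (u ++ image h y) (n + n') := by
  induction hr generalizing ν u n with
  | refl => simpa [image_nil] using H
  | @step p p' q' a l y n' hs hr ih =>
    have h₁ : (ν ++ a.toList.map Symbol.terminal).length ≤ m := by
      simp at hν ⊢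
      omega
    have := ih (by simpa using hν) h₁ (generates_right h₁ hν' hs H)
    rw [image_append, ← List.append_assoc, ← add_assoc, add_comm n]
    simpa using this

/-- A run on the empty word may still consist of `λ`-transitions; they are split off from the right
until both states agree. -/
theorem generates_nil (hm : ([] : List (Symbol Γ G.NT)).length ≤ m) {q q' : M.State}
    {α : List G.Index} {n : Fin K → ℕ} (hr : M.Run q [] n q') :
    (grammar h e).Generates [.nonterminal (e (some (⟨[], hm⟩, q, q')), α)] [] n := by
  have h₁ : (grammar h e).Generates [.nonterminal (e (some (⟨[], hm⟩, q, q)), α)] [] 0 := by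
    simpa using CounterIndexedGrammar.Generates.nonterminal (G := grammar h e) (IsRule.finish q hm)
      (.rewrite _ _ α) .nil
  simpa [image_nil] using generates_of_run_right hr hm hm h₁

theorem exists_of_expands (hG : G.IsLinear) (hm : 1 ≤ m)
    (hb : ∀ r ∈ G.rules, r.1.rhsLength ≤ m) {r : IndexedRule Γ G.NT G.Index × (Fin 0 → ℕ)}
    (hr : r ∈ G.rules) {A : G.NT} {α : List G.Index} {w : SententialForm Γ G.NT G.Index}
    (hw : r.1.Expands A α w) (hA : [Symbol.nonterminal A].length ≤ m) :
    ∃ (ν : List (Symbol Γ G.NT)) (β : List G.Index) (hν : ν.length ≤ m),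
      w = attachIndices β ν ∧ countNonterminals ν ≤ 1 ∧ ∀ (q q' : M.State) (u : List T)
        (n : Fin K → ℕ),
        (grammar h e).Generates [.nonterminal (e (some (⟨ν, hν⟩, q, q')), β)] u n →
          (grammar h e).Generates [.nonterminal (e (some (⟨_, hA⟩, q, q')), α)] u n := by
  have hlin := hG r.1 ⟨r, hr, rfl⟩
  have hlen := hb r hr
  obtain ⟨r, c⟩ := r
  cases hw with
  | rewrite A ν =>
    refine ⟨ν, α, hlen, rfl, hlin, fun q q' u n H => ?_⟩
    simpa using CounterIndexedGrammar.Generates.nonterminal (G := grammar h e)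
      (IsRule.rewrite q q' hr hA hlen) (.rewrite _ _ α) H
  | push A B f =>
    refine ⟨[.nonterminal B], f :: α, hm, rfl, le_rfl, fun q q' u n H => ?_⟩
    simpa using CounterIndexedGrammar.Generates.nonterminal (G := grammar h e)
      (IsRule.push q q' hr hA hm) (.push _ _ _ α) H
  | pop A f ν α =>
    refine ⟨ν, α, hlen, rfl, hlin, fun q q' u n H => ?_⟩
    simpa using CounterIndexedGrammar.Generates.nonterminal (G := grammar h e)
      (IsRule.pop q q' hr hA hlen) (.pop _ _ _ α) H

/-- The induction follows the leftmost derivation. The word `y` collects terminals to the right of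
`ν` that await an outer part of the run, which keeps `ν` within the length bound. Since the pair of
states is quantified inside the conclusion, the run may be cut after the induction hypothesis is
obtained. -/
theorem generates_of_generates (hG : G.IsLinear) (hm : 1 ≤ m)
    (hb : ∀ r ∈ G.rules, r.1.rhsLength ≤ m) {s : SententialForm Γ G.NT G.Index} {v : List Γ}
    {c : Fin 0 → ℕ} (H : G.Generates s v c) (ν : List (Symbol Γ G.NT)) (α : List G.Index)
    (y : List Γ) (hs : s = attachIndices α ν ++ y.map .terminal) (hlin : countNonterminals ν ≤ 1)
    (hν : ν.length ≤ m) :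
    ∃ x, v = x ++ y ∧ ∀ (q q' : M.State) (n : Fin K → ℕ), M.Run q x n q' →
      (grammar h e).Generates [.nonterminal (e (some (⟨ν, hν⟩, q, q')), α)] (image h x) n := by
  induction H generalizing ν α y with
  | nil =>
    cases ν with
    | nil =>
      obtain rfl : y = [] := by simpa [attachIndices] using hs.symm
      exact ⟨[], rfl, fun q q' n hr => by simpa [image_nil] using generates_nil hν hr⟩
    | cons => simp [attachIndices] at hs
  | @terminal a s v c H ih =>
    cases ν with
    | nil =>
      obtain ⟨rfl, -⟩ := CounterIndexedGrammar.Generates.eq_of_terminals (hs ▸ H.terminal a :)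
      exact ⟨[], rfl, fun q q' n hr => by simpa [image_nil] using generates_nil hν hr⟩
    | cons b ν =>
      cases b with
      | nonterminal B => simp [attachIndices] at hs
      | terminal b =>
        simp only [attachIndices, List.map_cons, List.cons_append, List.cons.injEq,
          Symbol.terminal.injEq] at hs
        obtain ⟨rfl, hs⟩ := hs
        have hν' : ν.length ≤ m := (Nat.le_succ _).trans hν
        obtain ⟨x, rfl, hx⟩ := ih ν α y hs hlin hν'
        exact ⟨a :: x, rfl, fun q q' n hr =>
          generates_of_run_left (w := [a]) hr hν hν' fun p n hr => hx p q' n hr⟩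
  | @nonterminal r hr A β w s v c hw H ih =>
    cases ν with
    | nil => cases y <;> simp [attachIndices] at hs
    | cons b ν =>
      cases b with
      | terminal b => simp [attachIndices] at hs
      | nonterminal B =>
        rw [countNonterminals_nonterminal_cons] at hlin
        obtain ⟨z, rfl⟩ := exists_eq_terminals (show countNonterminals ν = 0 by omega)
        have hs' : s = attachIndices α (z.map .terminal) ++ y.map .terminal ∧ A = B ∧ β = α := by
          simp only [attachIndices, List.map_cons, List.cons_append, List.cons.injEq,
            Symbol.nonterminal.injEq, Prod.mk.injEq] at hs
          exact ⟨hs.2, hs.1⟩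
        obtain ⟨rfl, rfl, rfl⟩ := hs'
        obtain ⟨ν, α, hν', rfl, hlin', hrule⟩ := exists_of_expands (h := h) (e := e) hG hm hb hr hw hm
        -- By linearity only terminals `z` follow the nonterminal; they join `y` and are later read
        -- from the right.
        obtain ⟨x, rfl, hx⟩ := ih ν α (z ++ y)
          (by rw [attachIndices_terminals, List.map_append]) hlin' hν'
        refine ⟨x ++ z, (List.append_assoc ..).symm, fun q q' n hr => ?_⟩
        obtain ⟨p, n₁, n₂, h₁, h₂, rfl⟩ := hr.exists_of_append
        rw [image_append]
        exact generates_of_run_right h₂ hν hm (hrule _ _ _ _ (hx _ _ _ h₁))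

theorem language_grammar (hG : G.IsLinear) (hm : 1 ≤ m)
    (hb : ∀ r ∈ G.rules, r.1.rhsLength ≤ m) :
    (grammar h e).language = homImage h (G.language ⊓ M.balancedLanguage) := by
  ext u
  rw [CounterIndexedGrammar.mem_language_iff]
  constructor
  · rintro ⟨n, H, hn⟩
    generalize hA : (grammar h e).initial = A at H
    cases H with
    | @nonterminal r hr _ _ w _ _ n hw H =>
      cases hr with
      | @start q q' hq hq' hm =>
        cases hw
        obtain ⟨v, rfl, hv, hrun⟩ := exists_of_generates H [] [] hm q q' [] rfl
        refine ⟨v, ⟨CounterIndexedGrammar.mem_language_iff.2 ⟨0, hv, fun i => i.elim0⟩,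
          q, hq, q', hq', n, hrun, by simpa using hn⟩, ?_⟩
        simp [image]
      -- Every other production rewrites a triple, never the start symbol `e none`.
      | _ => cases hw <;> simp at hA
  · rintro ⟨v, ⟨hv, q, hq, q', hq', n, hrun, hn⟩, rfl⟩
    obtain ⟨c, hc, -⟩ := CounterIndexedGrammar.mem_language_iff.1 hv
    obtain ⟨x, rfl, hx⟩ := generates_of_generates (h := h) (e := e) (M := M) hG hm hb hc
      [.nonterminal G.initial] [] [] rfl le_rfl hm
    rw [List.append_nil] at hrun ⊢
    refine ⟨n, ?_, hn⟩
    simpa [image] using CounterIndexedGrammar.Generates.nonterminal (G := grammar h e)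
      (IsRule.start hq hq' hm) (.rewrite _ _ []) (hx q q' n hrun)

end AutomatonProduct

/-! ### From a homomorphic image to counters -/

open AutomatonProduct in
theorem IsLinearIndexed.isLinearIndexedWithCounters_homImage {Γ T : Type u} [Finite Γ] [Finite T]
    (h : FreeMonoid Γ →* FreeMonoid T) {L₁ L₂ : Language Γ} (h₁ : IsLinearIndexed L₁)
    (h₂ : IsNCM L₂) : IsLinearIndexedWithCounters (homImage h (L₁ ⊓ L₂)) := by
  obtain ⟨G, hG, rfl⟩ := isLinearIndexed_iff.1 h₁
  obtain ⟨K, M, rfl⟩ := h₂.exists_weightedAutomaton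
  obtain ⟨b, hb⟩ := (G.finite_rules.image fun r => r.1.rhsLength).bddAbove
  have := G.finite_nt
  have := M.finite_state
  have := Symbol.finite (T := Γ) (N := G.NT)
  -- The bound is `b + 1` because words consisting of one nonterminal must be admitted even when `b
  -- = 0`.
  have : Finite {ν : List (Symbol Γ G.NT) // ν.length ≤ b + 1} := List.finite_length_le _ _
  obtain ⟨c, ⟨e⟩⟩ := Finite.exists_equiv_fin (NT G M (b + 1))
  exact ⟨K, grammar h e, grammar_isLinear h e, language_grammar hG (by omega) fun r hr =>
    (hb ⟨r, hr, rfl⟩).trans (Nat.le_succ b)⟩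

theorem mainTheorem5 {T : Type u} [Finite T] (L : Language T) :
    IsLinearIndexedWithCounters L ↔
      ∃ (Γ : Type u) (_ : Finite Γ) (h : FreeMonoid Γ →* FreeMonoid T) (L₁ L₂ : Language Γ),
        IsLinearIndexed L₁ ∧ IsNCM L₂ ∧ L = homImage h (L₁ ⊓ L₂) := by
  refine ⟨fun hL => hL.exists_eq_homImage, ?_⟩
  rintro ⟨Γ, _, h, L₁, L₂, h₁, h₂, rfl⟩
  exact h₁.isLinearIndexedWithCounters_homImage h h₂
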